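/- **Notation.** Let $D,E$ be separable complex Hilbert spaces, $m$ normalized Lebesgue measure on the unit circle $\mathbb T$, $L^2_E=L^2(\mathbb T,E)$, $\widehat f(n)=\int_{\mathbb T}\bar z^{\,n}f(z)\,dm(z)$, and $H^2_E=\{f\in L^2_E:\widehat f(n)=0 \text{ for } n<0\}$, identified with analytic functions on the unit disc $\mathbb D$ by $f(\zeta)=\sum_{n\ge0}\widehat f(n)\zeta^n$. Let $P_+$ and $P_-$ be the orthogonal projections of $L^2_E$ onto $H^2_E$ and $L^2_E\ominus H^2_E$. Functions on $\mathbb T$ are considered up to equality a.e. A *strong $L^2$-function* $\Phi\in L^2_s(\mathcal B(D,E))$ is a function $\Phi:\mathbb T\to\mathcal B(D,E)$ with $\Phi(\cdot)x\in L^2_E$ for every $x\in D$; $\Phi\in H^2_s(\mathcal B(D,E))$ means that moreover $\Phi(\cdot)x\in H^2_E$ for every $x\in D$. Put $\Phi^*(z)=\Phi(z)^*$, $\breve\Phi(z)=\Phi(\bar z)$, $\widetilde\Phi(z)=\Phi(\bar z)^*$. An *inner function* with values in $\mathcal B(D,E)$ is an essentially bounded, strongly measurable $\Delta:\mathbb T\to\mathcal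 B(D,E)$ with $\Delta(\cdot)x\in H^2_E$ for all $x\in D$ and with $\Delta(z)$ isometric for a.e. $z$. It is a *left inner divisor* of $\Psi\in H^2_s(\mathcal B(D',E))$ if $\Psi=\Delta G$ for some $G\in H^2_s(\mathcal B(D',D))$. Two functions in $H^2_s$ with the same codomain are *left coprime* if each of their common left inner divisors is a constant unitary operator, and $\Phi,\Psi$ are *right coprime* if $\widetilde\Phi,\widetilde\Psi$ are left coprime. For $F\subseteq H^2_E$ let $E_F^*$ be the smallest closed subspace of $H^2_E$ that contains $F$ and is invariant under the adjoint of the shift $S_Ef=zf$, and let $$\operatorname{nc}(F)=\sup_{\zeta\in\mathbb D}\dim\{g(\zeta):g\in H^2_E\ominus E_F^*\}\in\{0,1,2,\dots,\infty\}.$$ For an orthonormal basis $(d_k)$ of $D$, let $\{\Phi_+\}=\{P_+(\Phi(\cdot)d_k)\}_k\subseteq H^2_E$. Dimensions take values in $\{0,1,2,\dots,\infty\}$. The Hankel operator $H_\Phi:H^2_D\to H^2_E$ of a strong $L^2$-function $\Phi$ is the densely defined operator $H_\Phi p=JP_-(\Phi p)$ on the $D$-valued analytic polynomials $p$, where $(Jg)(z)=\bar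 z\,g(\bar z)$; $H_\Phi^*$ is its adjoint as a (possibly unbounded) operator. **Theorem.** Let $\Phi$ be a strong $L^2$-function with values in $\mathcal B(D,E)$. A *canonical decomposition* of $\Phi$ is an expression $$\Phi=\Delta A^*+B$$ with a separable complex Hilbert space $E'$ and functions $\Delta:\mathbb T\to\mathcal B(E',E)$, $A:\mathbb T\to\mathcal B(E',D)$, $B:\mathbb T\to\mathcal B(D,E)$ such that 1. $\Delta$ is inner, $\widetilde A\in H^2_s(\mathcal B(D,E'))$, and $B\in L^2_s(\mathcal B(D,E))$; 2. $\Delta$ and $A$ are right coprime; 3. $\Delta^*B=0$; 4. $\operatorname{nc}\{\Phi_+\}\le\dim E'$. (a) $\Phi$ has a canonical decomposition. (b) If $\Phi=\Delta_1A_1^*+B_1$ is a canonical decomposition with space $E_1'$ and $\dim E_1'<\infty$ (for instance, if $\dim E<\infty$), then $\ker H_{\breve\Phi}^*=\Delta_1H^2_{E_1'}$, and the decomposition is unique up to a unitary constant right factor: for every canonical decomposition $\Phi=\Delta_2A_2^*+B_2$ with space $E_2'$ there is a unitary operator $V:E_2'\to E_1'$ with $\Delta_2=\Delta_1V$, $A_2=A_1V$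 and $B_2=B_1$ a.e. on $\mathbb T$. -/

import Mathlib

open MeasureTheory AddCircle
open scoped InnerProductSpace ENNReal

universe u v w r s

noncomputable section

namespace StrongL2

/-! The unit circle `𝕋 = {z : |z| = 1}` is parametrised by `t ∈ ℝ / ℤ`, `z = e^{2πit}`; thus
`fourier n t = zⁿ`, the conjugate `z̄` corresponds to `-t`, and `m` is normalised Lebesgue measure. -/

/-- The unit circle. -/
abbrev 𝕋 : Type := UnitAddCircle

/-- Normalised Lebesgue measure on the unit circle. -/
abbrev m : Measure 𝕋 := haarAddCircle

/-- The Hilbert space `L²_E` of square integrable `E`-valued functions on the circle. -/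
abbrev L2 (E : Type*) [NormedAddCommGroup E] : Type _ := Lp E 2 m

section Spaces

variable {E : Type*} [NormedAddCommGroup E] [InnerProductSpace ℂ E]

theorem norm_fourier_apply (n : ℤ) (t : 𝕋) : ‖fourier n t‖ = 1 := by
  rw [fourier_apply]
  exact Circle.norm_coe _

theorem memLp_fourier_smul {p : ℝ≥0∞} {f : 𝕋 → E} (hf : MemLp f p m) (n : ℤ) :
    MemLp (fun t => fourier n t • f t) p m := by
  refine hf.of_le ((fourier n).continuous.aestronglyMeasurable.smul hf.1) ?_
  refine Filter.Eventually.of_forall fun t => ?_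
  simp only [norm_smul, norm_fourier_apply, one_mul, le_refl]

/-- Multiplication by `zⁿ` on `L²_E`. -/
def mulZ (n : ℤ) : L2 E →ₗᵢ[ℂ] L2 E where
  toFun f := (memLp_fourier_smul (Lp.memLp f) n).toLp _
  map_add' f g := by
    rw [← MemLp.toLp_add]
    refine MemLp.toLp_congr _ _ ?_
    filter_upwards [Lp.coeFn_add f g] with t ht
    change fourier n t • (f + g : L2 E) t = fourier n t • f t + fourier n t • g t
    rw [ht, Pi.add_apply, smul_add]
  map_smul' c f := by
    rw [RingHom.id_apply, ← MemLp.toLp_const_smul]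
    refine MemLp.toLp_congr _ _ ?_
    filter_upwards [Lp.coeFn_smul c f] with t ht
    change fourier n t • (c • f : L2 E) t = c • fourier n t • f t
    rw [ht, Pi.smul_apply, smul_comm]
  norm_map' f := by
    change ‖(memLp_fourier_smul (Lp.memLp f) n).toLp _‖ = ‖f‖
    rw [Lp.norm_toLp, Lp.norm_def]
    congr 1
    refine eLpNorm_congr_norm_ae (Filter.Eventually.of_forall fun t => ?_)
    simp only [norm_smul, norm_fourier_apply, one_mul]

theorem coeFn_mulZ (n : ℤ) (f : L2 E) : mulZ n f =ᵐ[m] fun t => fourier n t • f t :=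
  MemLp.coeFn_toLp (memLp_fourier_smul (Lp.memLp f) n)

/-- The monomial `zⁿ x` in `L²_E`. -/
def monomial (n : ℤ) (x : E) : L2 E := (memLp_fourier_smul (memLp_const x) n).toLp _

theorem coeFn_monomial (n : ℤ) (x : E) : monomial n x =ᵐ[m] fun t => fourier n t • x :=
  MemLp.coeFn_toLp _

set_option linter.unusedSectionVars false in
theorem integrable_L2 (f : L2 E) : Integrable f m :=
  (Lp.memLp f).integrable (by norm_num)

theorem fourierCoeff_mulZ (k : ℤ) (f : L2 E) (n : ℤ) :
    fourierCoeff (mulZ k f) n = fourierCoeff f (n - k) := by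
  unfold fourierCoeff
  refine integral_congr_ae ?_
  filter_upwards [coeFn_mulZ k f] with t ht
  rw [ht, smul_smul, ← fourier_add, show -n + k = -(n - k) by ring]

theorem inner_monomial [CompleteSpace E] (n : ℤ) (x : E) (f : L2 E) :
    ⟪monomial n x, f⟫_ℂ = ⟪x, fourierCoeff f n⟫_ℂ := by
  rw [L2.inner_def, fourierCoeff, ← integral_inner]
  · refine integral_congr_ae ?_
    filter_upwards [coeFn_monomial n x] with t ht
    rw [ht, inner_smul_left, inner_smul_right, fourier_neg]
  · exact (memLp_fourier_smul (Lp.memLp f) (-n)).integrable (by norm_num)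

variable (E) in
/-- The Hardy space `H²_E`: the functions in `L²_E` whose negative Fourier coefficients vanish. -/
def H2 : Submodule ℂ (L2 E) where
  carrier := {f | ∀ n : ℤ, n < 0 → fourierCoeff f n = 0}
  zero_mem' n _ := by
    rw [fourierCoeff_congr_ae (Lp.coeFn_zero E 2 m)]
    simp [fourierCoeff]
  add_mem' {f g} hf hg n hn := by
    rw [fourierCoeff_congr_ae (Lp.coeFn_add f g),
      fourierCoeff.add (integrable_L2 f) (integrable_L2 g), Pi.add_apply, hf n hn, hg n hn,
      add_zero]
  smul_mem' c f hf n hn := by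
    rw [fourierCoeff_congr_ae (Lp.coeFn_smul c f)]
    change fourierCoeff (c • (f : 𝕋 → E)) n = 0
    rw [fourierCoeff.const_smul, hf n hn, smul_zero]

theorem mem_H2 {f : L2 E} : f ∈ H2 E ↔ ∀ n : ℤ, n < 0 → fourierCoeff f n = 0 := Iff.rfl

theorem H2_eq [CompleteSpace E] :
    H2 E = (Submodule.span ℂ {g | ∃ n : ℤ, n < 0 ∧ ∃ x : E, g = monomial n x})ᗮ := by
  ext f
  rw [mem_H2, Submodule.mem_orthogonal]
  constructor
  · intro h g hg
    induction hg using Submodule.span_induction with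
    | mem g hg =>
      obtain ⟨n, hn, x, rfl⟩ := hg
      rw [inner_monomial, h n hn, inner_zero_right]
    | zero => exact inner_zero_left _
    | add a b _ _ ha hb => rw [inner_add_left, ha, hb, add_zero]
    | smul c a _ ha => rw [inner_smul_left, ha, mul_zero]
  · intro h n hn
    refine ext_inner_left ℂ fun x => ?_
    rw [← inner_monomial, inner_zero_right]
    exact h _ (Submodule.subset_span ⟨n, hn, x, rfl⟩)

instance [CompleteSpace E] : CompleteSpace (H2 E) := by
  rw [H2_eq]
  infer_instance

theorem monomial_mem_H2 [CompleteSpace E] (n : ℕ) (x : E) : monomial (n : ℤ) x ∈ H2 E := by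
  intro k hk
  rw [fourierCoeff_congr_ae (coeFn_monomial (n : ℤ) x)]
  have h : fourierCoeff (fun t : 𝕋 => fourier (n : ℤ) t • x) k
      = (fourierCoeff (fourier (n : ℤ) : 𝕋 → ℂ) k) • x := by
    unfold fourierCoeff
    rw [← integral_smul_const]
    simp [smul_smul]
  rw [h, fourierCoeff_fourier, Pi.single_eq_of_ne (by omega), zero_smul]

variable (E) in
/-- The space `𝒫_E` of `E`-valued analytic polynomials `∑ zᵏ xₖ`, as a subspace of `H²_E`. -/
def polynomials [CompleteSpace E] : Submodule ℂ (H2 E) :=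
  Submodule.span ℂ {p | ∃ (n : ℕ) (x : E), (p : L2 E) = monomial (n : ℤ) x}

variable (E) in
/-- The shift `S_E f = z f` on `H²_E`. -/
def shift : H2 E →L[ℂ] H2 E :=
  ((mulZ 1).toContinuousLinearMap.comp (H2 E).subtypeL).codRestrict (H2 E) (by
    intro f n hn
    change fourierCoeff (mulZ 1 (f : L2 E)) n = 0
    rw [fourierCoeff_mulZ]
    exact f.2 _ (by omega))

variable (E) in
/-- The unitary operator `(J g)(z) = z̄ g(z̄)` on `L²_E`. -/
def J : L2 E →ₗᵢ[ℂ] L2 E :=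
  (mulZ (-1)).comp
    (Lp.compMeasurePreservingₗᵢ ℂ (fun t : 𝕋 => -t) (Measure.measurePreserving_neg m))

theorem coeFn_J (g : L2 E) : J E g =ᵐ[m] fun t => fourier (-1) t • g (-t) := by
  filter_upwards [coeFn_mulZ (-1) (Lp.compMeasurePreservingₗᵢ ℂ (fun t : 𝕋 => -t)
    (Measure.measurePreserving_neg m) g),
    Lp.coeFn_compMeasurePreserving g (Measure.measurePreserving_neg m)] with t h1 h2
  exact h1.trans (congrArg _ h2)

theorem fourierCoeff_J (g : L2 E) (n : ℤ) :
    fourierCoeff (J E g) n = fourierCoeff g (-n - 1) := by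
  rw [fourierCoeff_congr_ae (coeFn_J g)]
  unfold fourierCoeff
  rw [← integral_neg_eq_self]
  refine integral_congr_ae (Filter.Eventually.of_forall fun t => ?_)
  simp only [neg_neg, smul_smul]
  congr 1
  simp only [fourier_apply, ← Circle.coe_mul, ← toCircle_add, ← add_smul]
  congr 2
  ring_nf
  module

theorem J_mem_H2 [CompleteSpace E] {g : L2 E} (hg : g ∈ (H2 E)ᗮ) : J E g ∈ H2 E := by
  intro n hn
  rw [fourierCoeff_J]
  refine ext_inner_left ℂ fun x => ?_
  rw [← inner_monomial, inner_zero_right]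
  obtain ⟨k, hk⟩ := Int.eq_ofNat_of_zero_le (show 0 ≤ -n - 1 by omega)
  rw [hk]
  exact (Submodule.mem_orthogonal _ _).1 hg _ (monomial_mem_H2 k x)

/-- The value `g(ζ) = ∑ ĝ(n) ζⁿ` of `g ∈ H²_E` at a point `ζ` of the open unit disc, under the usual
identification of `H²_E` with a space of analytic functions on the disc. -/
def evalDisc (ζ : ℂ) (g : H2 E) : E := ∑' n : ℕ, ζ ^ n • fourierCoeff (g : L2 E) (n : ℤ)

/-- The dimension of a complex vector space, a natural number or `∞`. -/
def dim (V : Type*) [AddCommGroup V] [Module ℂ V] : ℕ∞ := Cardinal.toENat (Module.rank ℂ V)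

variable [CompleteSpace E]

/-- `E_F^*`, the smallest closed `S_E^*`-invariant subspace of `H²_E` containing `F`, that is the
closed linear span of all `S_E^{*n} F`. -/
def backwardSpan (F : Set (H2 E)) : Submodule ℂ (H2 E) :=
  (Submodule.span ℂ {g | ∃ n : ℕ, ∃ f ∈ F,
    g = ((ContinuousLinearMap.adjoint (shift E)) ^ n) f}).topologicalClosure

/-- The degree of non-cyclicity `nc(F) = sup_{|ζ| < 1} dim {g(ζ) : g ∈ H²_E ⊖ E_F^*}`. The set
`{g(ζ)}` is a linear subspace, so that taking its span changes nothing. -/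
def nc (F : Set (H2 E)) : ℕ∞ :=
  ⨆ ζ ∈ Metric.ball (0 : ℂ) 1, dim (Submodule.span ℂ {e : E | ∃ g ∈ (backwardSpan F)ᗮ, e = evalDisc ζ g})

end Spaces

section Functions

variable {D E : Type*} [NormedAddCommGroup D] [InnerProductSpace ℂ D]
  [NormedAddCommGroup E] [InnerProductSpace ℂ E]

/-- Strong `L²`-functions: `Φ(·)x ∈ L²_E` for each `x ∈ D`. -/
def IsStrongL2 (Φ : 𝕋 → D →L[ℂ] E) : Prop := ∀ x : D, MemLp (fun t => Φ t x) 2 m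

/-- `Φ ∈ H²_s(ℬ(D,E))`: strong `L²`-functions whose negative Fourier coefficients vanish. -/
def IsStrongH2 (Φ : 𝕋 → D →L[ℂ] E) : Prop :=
  IsStrongL2 Φ ∧ ∀ x : D, ∀ n : ℤ, n < 0 → fourierCoeff (fun t => Φ t x) n = 0

/-- `Φ ∈ H^∞(ℬ(D,E))`: essentially bounded, measurable in the strong operator topology, with
vanishing negative Fourier coefficients. -/
def IsHInfty (Φ : 𝕋 → D →L[ℂ] E) : Prop :=
  (∀ x : D, AEStronglyMeasurable (fun t => Φ t x) m) ∧ (∃ C : ℝ, ∀ᵐ t ∂m, ‖Φ t‖ ≤ C) ∧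
    ∀ x : D, ∀ n : ℤ, n < 0 → fourierCoeff (fun t => Φ t x) n = 0

/-- Inner functions with values in `ℬ(D,E)`: functions in `H^∞` that are isometric almost
everywhere. -/
def IsInner (Δ : 𝕋 → D →L[ℂ] E) : Prop := IsHInfty Δ ∧ ∀ᵐ t ∂m, Isometry (Δ t)

/-- The flip `Φ̆(z) = Φ(z̄)`. -/
def flip (Φ : 𝕋 → D →L[ℂ] E) : 𝕋 → D →L[ℂ] E := fun t => Φ (-t)

theorem IsStrongL2.flip {Φ : 𝕋 → D →L[ℂ] E} (hΦ : IsStrongL2 Φ) : IsStrongL2 (flip Φ) :=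
  fun x => (hΦ x).comp_measurePreserving (Measure.measurePreserving_neg m)

/-- `Δ` is a left inner divisor of `Φ`: `Δ` is inner and `Φ = Δ A` with `A` in `H²_s`. -/
def IsLeftInnerDivisor {D' : Type*} [NormedAddCommGroup D'] [InnerProductSpace ℂ D']
    (Δ : 𝕋 → D' →L[ℂ] E) (Φ : 𝕋 → D →L[ℂ] E) : Prop :=
  IsInner Δ ∧ ∃ A : 𝕋 → D →L[ℂ] D', IsStrongH2 A ∧ ∀ᵐ t ∂m, Φ t = Δ t ∘L A t

variable [CompleteSpace D] [CompleteSpace E]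

/-- `Φ̃(z) = Φ(z̄)^*`. -/
def tilde (Φ : 𝕋 → D →L[ℂ] E) : 𝕋 → E →L[ℂ] D :=
  fun t => ContinuousLinearMap.adjoint (Φ (-t))

set_option linter.unusedSectionVars false in
theorem memLp_apply_polynomial {Φ : 𝕋 → D →L[ℂ] E} (hΦ : IsStrongL2 Φ) (p : polynomials D) :
    MemLp (fun t => Φ t (((p : H2 D) : L2 D) t)) 2 m := by
  obtain ⟨p, hp⟩ := p
  change MemLp (fun t => Φ t ((p : L2 D) t)) 2 m
  induction hp using Submodule.span_induction with
  | mem p hp =>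
    obtain ⟨n, x, hx⟩ := hp
    rw [hx]
    refine (memLp_fourier_smul (hΦ x) n).ae_eq ?_
    filter_upwards [coeFn_monomial (n : ℤ) x] with t ht
    simp [ht]
  | zero =>
    refine (MemLp.zero (ε := E) (p := 2) (μ := m)).ae_eq ?_
    filter_upwards [Lp.coeFn_zero D 2 m] with t ht
    change 0 = Φ t ((0 : L2 D) t)
    rw [ht, Pi.zero_apply, map_zero]
  | add a b _ _ ha hb =>
    refine (ha.add hb).ae_eq ?_
    filter_upwards [Lp.coeFn_add (a : L2 D) (b : L2 D)] with t ht
    change Φ t (a.1 t) + Φ t (b.1 t) = Φ t ((a.1 + b.1 : L2 D) t)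
    rw [ht, Pi.add_apply, map_add]
  | smul c a _ ha =>
    refine (ha.const_smul c).ae_eq ?_
    filter_upwards [Lp.coeFn_smul c (a : L2 D)] with t ht
    change c • Φ t (a.1 t) = Φ t ((c • a.1 : L2 D) t)
    rw [ht, Pi.smul_apply, map_smul]

/-- The pointwise product `Φ p ∈ L²_E` of a strong `L²`-function and a polynomial. -/
def mulPolynomial {Φ : 𝕋 → D →L[ℂ] E} (hΦ : IsStrongL2 Φ) : polynomials D →ₗ[ℂ] L2 E where
  toFun p := (memLp_apply_polynomial hΦ p).toLp _
  map_add' p q := by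
    rw [← MemLp.toLp_add]
    refine MemLp.toLp_congr _ _ ?_
    filter_upwards [Lp.coeFn_add ((p : H2 D) : L2 D) ((q : H2 D) : L2 D)] with t ht
    change Φ t ((((p : H2 D) : L2 D) + ((q : H2 D) : L2 D) : L2 D) t) = _
    rw [ht, Pi.add_apply, map_add]
    rfl
  map_smul' c p := by
    rw [RingHom.id_apply, ← MemLp.toLp_const_smul]
    refine MemLp.toLp_congr _ _ ?_
    filter_upwards [Lp.coeFn_smul c ((p : H2 D) : L2 D)] with t ht
    change Φ t ((c • ((p : H2 D) : L2 D) : L2 D) t) = _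
    rw [ht, Pi.smul_apply, map_smul]
    rfl

/-- The Hankel operator `H_Φ p = J P_-(Φ p)`, `p ∈ 𝒫_D`, a densely defined, possibly unbounded
operator from `H²_D` to `H²_E`; here `P_-` is the orthogonal projection onto `L²_E ⊖ H²_E`. -/
def hankel {Φ : 𝕋 → D →L[ℂ] E} (hΦ : IsStrongL2 Φ) : H2 D →ₗ.[ℂ] H2 E where
  domain := polynomials D
  toFun := LinearMap.codRestrict (H2 E)
    ((J E).toLinearMap ∘ₗ ((H2 E)ᗮ.starProjection : L2 E →ₗ[ℂ] L2 E) ∘ₗ mulPolynomial hΦ)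
    (fun _ => J_mem_H2 (Submodule.starProjection_apply_mem _ _))

/-- The kernel of the adjoint (in the sense of unbounded operators) of a Hankel operator. -/
def kerHankelAdjoint {Φ : 𝕋 → D →L[ℂ] E} (hΦ : IsStrongL2 Φ) : Set (H2 E) :=
  {f | ∃ hf : f ∈ (hankel hΦ).adjoint.domain, (hankel hΦ).adjoint ⟨f, hf⟩ = 0}

/-- The set `{Φ₊}` of columns of the analytic part of `Φ`, with respect to the orthonormal basis
`b` of `D`: the `k`-th column is `P₊(Φ(·) bₖ) ∈ H²_E`. -/
def analyticColumns {ι : Type*} (b : HilbertBasis ι ℂ D) {Φ : 𝕋 → D →L[ℂ] E}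
    (hΦ : IsStrongL2 Φ) : Set (H2 E) :=
  Set.range fun k => (H2 E).orthogonalProjectionOnto ((hΦ (b k)).toLp _)

/-- The set `Δ H²_{D}` of all products `Δ g`, `g ∈ H²_D`, as a subset of `H²_E`. -/
def rangeH2 (Δ : 𝕋 → D →L[ℂ] E) : Set (H2 E) :=
  {f | ∃ g : H2 D, ((f : L2 E) : 𝕋 → E) =ᵐ[m] fun t => Δ t ((g : L2 D) t)}

end Functions

/-- `Φ` and `Ψ` in `H²_s` are left coprime: every common left inner divisor is a (constant) unitary
operator. (The initial space of an inner function with values in `ℬ(D', E)` is isometric to a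
subspace of `E`, so that it is no restriction to take it in the universe of `E`.) -/
def LeftCoprime {D₁ : Type v} {D₂ : Type w} {E : Type u}
    [NormedAddCommGroup D₁] [InnerProductSpace ℂ D₁]
    [NormedAddCommGroup D₂] [InnerProductSpace ℂ D₂]
    [NormedAddCommGroup E] [InnerProductSpace ℂ E]
    (Φ : 𝕋 → D₁ →L[ℂ] E) (Ψ : 𝕋 → D₂ →L[ℂ] E) : Prop :=
  ∀ (D' : Type u) [NormedAddCommGroup D'] [InnerProductSpace ℂ D'] [CompleteSpace D']
    [TopologicalSpace.SeparableSpace D'] (Ω : 𝕋 → D' →L[ℂ] E),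
    IsLeftInnerDivisor Ω Φ → IsLeftInnerDivisor Ω Ψ →
      ∃ U : D' ≃ₗᵢ[ℂ] E, ∀ᵐ t ∂m, Ω t = U.toContinuousLinearEquiv.toContinuousLinearMap

section Decomposition

variable {D E E' : Type*} [NormedAddCommGroup D] [InnerProductSpace ℂ D] [CompleteSpace D]
  [NormedAddCommGroup E] [InnerProductSpace ℂ E] [CompleteSpace E]
  [NormedAddCommGroup E'] [InnerProductSpace ℂ E'] [CompleteSpace E']

/-- `Φ` and `Ψ` are right coprime: `Φ̃` and `Ψ̃` are left coprime. -/
def RightCoprime (Φ : 𝕋 → E' →L[ℂ] E) (Ψ : 𝕋 → E' →L[ℂ] D) : Prop :=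
  LeftCoprime (tilde Φ) (tilde Ψ)

/-- `Φ = Δ A^* + B` is a canonical decomposition of the strong `L²`-function `Φ`, where `b` is an
orthonormal basis of `D`, used to form the columns of `Φ₊`. -/
structure IsCanonicalDecomposition {ι : Type*} (b : HilbertBasis ι ℂ D) {Φ : 𝕋 → D →L[ℂ] E}
    (hΦ : IsStrongL2 Φ) (Δ : 𝕋 → E' →L[ℂ] E) (A : 𝕋 → E' →L[ℂ] D) (B : 𝕋 → D →L[ℂ] E) :
    Prop where
  eq_add : ∀ᵐ t ∂m, Φ t = Δ t ∘L ContinuousLinearMap.adjoint (A t) + B t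
  inner : IsInner Δ
  strongH2 : IsStrongH2 (tilde A)
  strongL2 : IsStrongL2 B
  coprime : RightCoprime Δ A
  adjoint_mul : ∀ᵐ t ∂m, ContinuousLinearMap.adjoint (Δ t) ∘L B t = 0
  nc_le : nc (analyticColumns b hΦ) ≤ dim E'

end Decomposition

end StrongL2

end

open MeasureTheory AddCircle
open scoped InnerProductSpace ENNReal

noncomputable section

namespace StrongL2

/-! ### Strong measurability of operator functions -/

section Measurability

variable {X : Type*} [MeasurableSpace X] {μ : Measure X}
  {D E : Type*} [NormedAddCommGroup D] [InnerProductSpace ℂ D]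
  [NormedAddCommGroup E] [InnerProductSpace ℂ E]

/-! Everything is governed by the space K of those f ∈ H²_E for which Φ^*f is weakly analytic. Since
the flips in Φ̆ and in J cancel, K is the kernel of H_{Φ̆}^* (`mem_kerHankelAdjoint_flip`). It is
closed and shift invariant, so K = ΔH² with Δ inner by Beurling–Lax–Halmos
(`exists_inner_of_shift_invariant`).

Existence. Put A = Φ^*Δ and B = (1 - ΔΔ^*)Φ. Analyticity of Ã says exactly that the columns of Δ lie
in K (`IsInner.isStrongH2_tilde_iff`). If Ω is a common left inner divisor of Δ̃ and Ã, then ΔΩ̆ is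
inner with columns in K = ΔH², so both Ω and Ω̆ are analytic and Ω is constant
(`IsInner.rightCoprime`).

Non-cyclicity. The complement of E_F^*, F = {Φ₊}, lies between zK and K. Hence its values at ζ lie
in the range of Δ(ζ), giving nc ≤ dim E'. Conversely nc ≥ dim E', because finitely many orthonormal
vectors have independent images under zΔ at some point of the disc
(`IsInner.exists_linearIndependent`).

Uniqueness. Any canonical decomposition has A₁ = Φ^*Δ₁, so the columns of Δ₁ lie in K and Δ₁ = ΔΘ
with Θ inner. If dim E₁ < ∞, then dim E' ≤ nc ≤ dim E₁ forces Θ to be unitary valued. Then Θ̃ is, up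
to a constant unitary, a common left inner divisor of Δ̃₁ and Ã₁, so coprimality makes Θ constant
(`IsCanonicalDecomposition.exists_unitary_factor`). -/

theorem aestronglyMeasurable_clm_apply {Φ : X → D →L[ℂ] E}
    (hΦ : ∀ x, AEStronglyMeasurable (fun t => Φ t x) μ) {f : X → D}
    (hf : AEStronglyMeasurable f μ) : AEStronglyMeasurable (fun t => Φ t (f t)) μ := by
  have key : ∀ s : SimpleFunc X D, AEStronglyMeasurable (fun t => Φ t (s t)) μ := by
    intro s
    induction s using SimpleFunc.induction with
    | @const c S hs =>
      refine ((hΦ c).indicator hs).congr (Filter.Eventually.of_forall fun t => ?_)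
      by_cases ht : t ∈ S <;> simp [Set.indicator, Set.piecewise, ht]
    | @add f g _ hf hg =>
      refine (hf.add hg).congr (Filter.Eventually.of_forall fun t => ?_)
      simp
  obtain ⟨g, hg, hfg⟩ := hf
  -- Simple functions approximate pointwise and each Φ(t) is continuous, so no norm measurability of
  -- Φ is needed.
  have h : AEStronglyMeasurable (fun t => Φ t (g t)) μ :=
    aestronglyMeasurable_of_tendsto_ae Filter.atTop (fun n => key (hg.approx n))
      (Filter.Eventually.of_forall fun t =>
        ((Φ t).continuous.tendsto _).comp (hg.tendsto_approx t))
  refine h.congr ?_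
  filter_upwards [hfg] with t ht
  rw [ht]

/-- Orthonormal vectors are √2 apart, so the balls of radius 1/2 around them are disjoint open sets.
-/
theorem _root_.Orthonormal.countable_of_separable {ι : Type*} [TopologicalSpace.SeparableSpace D]
    {b : ι → D} (hb : Orthonormal ℂ b) : Countable ι := by
  rw [← Set.countable_univ_iff]
  refine Set.PairwiseDisjoint.countable_of_isOpen (s := fun i => Metric.ball (b i) (1 / 2))
    ?_ (fun i _ => Metric.isOpen_ball) (fun i _ => ⟨b i, Metric.mem_ball_self (by norm_num)⟩)
  intro i _ j _ hij
  refine Metric.ball_disjoint_ball ?_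
  have h : ‖b i - b j‖ ^ 2 = 2 := by
    rw [@norm_sub_sq ℂ, hb.2 hij, hb.1 i, hb.1 j]
    norm_num
  rw [dist_eq_norm]
  nlinarith [norm_nonneg (b i - b j)]

/-- Expand in an orthonormal basis. Its countability makes the finite partial sums a countably
generated net, so that their pointwise limit is measurable. -/
theorem aestronglyMeasurable_of_inner [CompleteSpace D] [TopologicalSpace.SeparableSpace D]
    {f : X → D} (hf : ∀ x : D, AEStronglyMeasurable (fun t => ⟪x, f t⟫_ℂ) μ) :
    AEStronglyMeasurable f μ := by
  obtain ⟨w, b, -⟩ := exists_hilbertBasis ℂ D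
  have : Countable w := b.orthonormal.countable_of_separable
  refine aestronglyMeasurable_of_tendsto_ae (Filter.atTop : Filter (Finset w))
    (f := fun s t => ∑ i ∈ s, ⟪b i, f t⟫_ℂ • b i) (fun s => ?_)
    (Filter.Eventually.of_forall fun t => ?_)
  · refine Finset.aestronglyMeasurable_fun_sum s fun i _ => ?_
    exact (hf (b i)).smul aestronglyMeasurable_const
  · have := b.hasSum_repr (f t)
    simp only [b.repr_apply_apply] at this
    exact this

theorem aestronglyMeasurable_adjoint [CompleteSpace D] [CompleteSpace E]
    [TopologicalSpace.SeparableSpace D] {Φ : X → D →L[ℂ] E}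
    (hΦ : ∀ x, AEStronglyMeasurable (fun t => Φ t x) μ) (y : E) :
    AEStronglyMeasurable (fun t => ContinuousLinearMap.adjoint (Φ t) y) μ := by
  refine aestronglyMeasurable_of_inner fun x => ?_
  simp only [ContinuousLinearMap.adjoint_inner_right]
  exact (hΦ x).inner aestronglyMeasurable_const

end Measurability

/-! ### Uniqueness of Fourier coefficients and density of polynomials -/

section Fourier

variable {E : Type*} [NormedAddCommGroup E] [InnerProductSpace ℂ E] [CompleteSpace E]

/-- Trigonometric polynomials are dense in C(𝕋), so f integrates to zero against every continuous
function, and through thickened indicators over every closed set. The L¹ form is needed for the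
scalar functions ⟪x(t), y(t)⟫. -/
theorem ae_eq_zero_of_fourierCoeff_eq_zero {f : 𝕋 → E} (hf : Integrable f m)
    (h : ∀ n : ℤ, fourierCoeff f n = 0) : f =ᵐ[m] 0 := by
  have hint : ∀ g : C(𝕋, ℂ), Integrable (fun t => g t • f t) m := fun g =>
    hf.bdd_smul ‖g‖ g.continuous.aestronglyMeasurable
      (Filter.Eventually.of_forall fun t => g.norm_coe_le_norm t)
  let L : C(𝕋, ℂ) →L[ℂ] E := LinearMap.mkContinuous
    { toFun := fun g => ∫ t, g t • f t ∂m
      map_add' := fun g k => by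
        rw [← integral_add (hint g) (hint k)]
        simp [add_smul]
      map_smul' := fun c g => by
        rw [RingHom.id_apply, ← integral_smul]
        simp [smul_smul] } (∫ t, ‖f t‖ ∂m) (fun g => by
      change ‖∫ t, g t • f t ∂m‖ ≤ _
      rw [mul_comm, ← integral_const_mul]
      refine norm_integral_le_of_norm_le (hf.norm.const_mul _) (Filter.Eventually.of_forall ?_)
      intro t
      rw [norm_smul]
      gcongr
      exact g.norm_coe_le_norm t)
  have hL : L = 0 := by
    refine ContinuousLinearMap.ext_on (s := Set.range (@fourier 1)) ?_ ?_
    · rw [← Submodule.dense_iff_topologicalClosure_eq_top.symm]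
      exact span_fourier_closure_eq_top
    · rintro _ ⟨n, rfl⟩
      have := h (-n)
      rw [fourierCoeff, neg_neg] at this
      exact this
  have hg : ∀ g : C(𝕋, ℂ), ∫ t, g t • f t ∂m = 0 := fun g =>
    show L g = 0 by rw [hL]; rfl
  refine ae_eq_zero_of_forall_setIntegral_isClosed_eq_zero hf fun s hs => ?_
  have hpos : ∀ n : ℕ, (0 : ℝ) < 1 / ((n : ℝ) + 1) := fun n => by positivity
  have hlim := thickenedIndicator_tendsto_indicator_closure hpos
    tendsto_one_div_add_atTop_nhds_zero_nat s
  rw [tendsto_pi_nhds, hs.closure_eq] at hlim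
  have hconv : Filter.Tendsto (fun n : ℕ => ∫ t, ((thickenedIndicator (hpos n) s t : ℝ) : ℂ) • f t ∂m)
      Filter.atTop (nhds (∫ t, s.indicator f t ∂m)) := by
    refine tendsto_integral_of_dominated_convergence (fun t => ‖f t‖) (fun n => ?_) hf.norm
      (fun n => Filter.Eventually.of_forall fun t => ?_) (Filter.Eventually.of_forall fun t => ?_)
    · refine AEStronglyMeasurable.smul ?_ hf.1
      refine Continuous.aestronglyMeasurable ?_
      have := (thickenedIndicator (hpos n) s).continuous
      fun_prop
    · rw [norm_smul]
      refine mul_le_of_le_one_left (norm_nonneg _) ?_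
      simpa using thickenedIndicator_le_one (hpos n) s t
    · have h1 := hlim t
      have h2 : Filter.Tendsto (fun n : ℕ => ((thickenedIndicator (hpos n) s t : ℝ) : ℂ) • f t)
          Filter.atTop (nhds ((((s.indicator (fun _ => (1 : NNReal)) t : NNReal) : ℝ) : ℂ) • f t)) := by
        refine Filter.Tendsto.smul_const ?_ _
        exact (Complex.continuous_ofReal.tendsto _).comp
          ((NNReal.continuous_coe.tendsto _).comp h1)
      convert h2 using 2
      by_cases ht : t ∈ s <;> simp [ht]
  rw [← integral_indicator hs.measurableSet]
  refine tendsto_nhds_unique hconv ?_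
  have hz : ∀ n : ℕ, ∫ t, ((thickenedIndicator (hpos n) s t : ℝ) : ℂ) • f t ∂m = 0 := fun n =>
    hg ⟨fun t => ((thickenedIndicator (hpos n) s t : ℝ) : ℂ), by
      have := (thickenedIndicator (hpos n) s).continuous
      fun_prop⟩
  rw [funext hz]
  exact tendsto_const_nhds

theorem ext_fourierCoeff {f g : L2 E} (h : ∀ n : ℤ, fourierCoeff f n = fourierCoeff g n) :
    f = g := by
  rw [← sub_eq_zero]
  refine (Lp.eq_zero_iff_ae_eq_zero).2 (ae_eq_zero_of_fourierCoeff_eq_zero (integrable_L2 _) ?_)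
  intro n
  refine ext_inner_left ℂ fun x => ?_
  rw [← inner_monomial, inner_sub_right, inner_monomial, inner_monomial, h, sub_self,
    inner_zero_right]

omit [CompleteSpace E] in
@[simp] theorem mulZ_zero (f : L2 E) : mulZ 0 f = f := by
  refine Lp.ext ?_
  filter_upwards [coeFn_mulZ 0 f] with t ht
  rw [ht, fourier_zero, one_smul]

omit [CompleteSpace E] in
theorem mulZ_mulZ (k n : ℤ) (f : L2 E) : mulZ k (mulZ n f) = mulZ (k + n) f := by
  refine Lp.ext ?_
  filter_upwards [coeFn_mulZ k (mulZ n f), coeFn_mulZ n f, coeFn_mulZ (k + n) f] with t h1 h2 h3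
  rw [h1, h2, h3, smul_smul, fourier_add]

omit [CompleteSpace E] in
theorem inner_mulZ_left (n : ℤ) (f g : L2 E) : ⟪mulZ n f, g⟫_ℂ = ⟪f, mulZ (-n) g⟫_ℂ := by
  rw [← (mulZ (-n)).inner_map_map, mulZ_mulZ, neg_add_cancel, mulZ_zero]

omit [CompleteSpace E] in
theorem fourierCoeff_inner (f g : L2 E) (n : ℤ) :
    fourierCoeff (fun t => ⟪f t, g t⟫_ℂ) n = ⟪mulZ n f, g⟫_ℂ := by
  rw [L2.inner_def, fourierCoeff]
  refine integral_congr_ae ?_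
  filter_upwards [coeFn_mulZ n f] with t ht
  rw [ht, inner_smul_left, fourier_neg, smul_eq_mul]

omit [CompleteSpace E] in
theorem integrable_inner_L2 (f g : L2 E) : Integrable (fun t => ⟪f t, g t⟫_ℂ) m :=
  L2.integrable_inner f g

variable (E) in
/-- The embedding of `E` into `L²_E` as the constant functions. -/
def constL : E →L[ℂ] L2 E :=
  LinearMap.mkContinuous
    { toFun := fun x => monomial 0 x
      map_add' := fun x y => by
        refine Lp.ext ?_
        filter_upwards [coeFn_monomial 0 x, coeFn_monomial 0 y, coeFn_monomial 0 (x + y),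
          Lp.coeFn_add (monomial 0 x) (monomial 0 y)] with t h1 h2 h3 h4
        rw [h3, h4, Pi.add_apply, h1, h2, smul_add]
      map_smul' := fun c x => by
        refine Lp.ext ?_
        filter_upwards [coeFn_monomial 0 x, coeFn_monomial 0 (c • x),
          Lp.coeFn_smul c (monomial 0 x)] with t h1 h2 h3
        rw [h2, RingHom.id_apply, h3, Pi.smul_apply, h1, smul_comm] } 1 (fun x => by
    change ‖(memLp_fourier_smul (memLp_const x) 0).toLp _‖ ≤ _
    rw [Lp.norm_toLp, eLpNorm_congr_norm_ae (g := fun _ => x)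
      (Filter.Eventually.of_forall fun t => by rw [fourier_zero, one_smul]),
      eLpNorm_const _ (by norm_num) (IsProbabilityMeasure.ne_zero _)]
    simp)

omit [CompleteSpace E] in
theorem constL_apply (x : E) : constL E x = monomial 0 x := rfl

omit [CompleteSpace E] in
theorem coeFn_constL (x : E) : constL E x =ᵐ[m] fun _ => x := by
  filter_upwards [coeFn_monomial 0 x] with t ht
  rw [constL_apply, ht, fourier_zero, one_smul]

omit [CompleteSpace E] in
theorem mulZ_constL (n : ℤ) (x : E) : mulZ n (constL E x) = monomial n x := by
  refine Lp.ext ?_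
  filter_upwards [coeFn_monomial n x, coeFn_constL x, coeFn_mulZ n (constL E x)] with t h1 h2 h3
  rw [h1, h3, h2]

theorem constL_mem_H2 (x : E) : constL E x ∈ H2 E := monomial_mem_H2 0 x

omit [CompleteSpace E] in
theorem mulZ_mem_H2 {f : L2 E} (hf : f ∈ H2 E) (n : ℕ) : mulZ n f ∈ H2 E := fun k hk => by
  rw [fourierCoeff_mulZ]
  exact hf _ (by omega)

/-- A closed subspace that contains all monomials `zⁿ x`, `n ≥ 0`, contains `H²_E`. -/
theorem H2_le_of_monomial_mem {K : Submodule ℂ (L2 E)} (hK : IsClosed (K : Set (L2 E)))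
    (h : ∀ (n : ℕ) (x : E), monomial (n : ℤ) x ∈ K) : H2 E ≤ K := by
  let S : Submodule ℂ (L2 E) := (Submodule.span ℂ {g | ∃ (n : ℕ) (x : E), g = monomial (n : ℤ) x})
  have hSK : S.topologicalClosure ≤ K := by
    refine Submodule.topologicalClosure_minimal _ (Submodule.span_le.2 ?_) hK
    rintro _ ⟨n, x, rfl⟩
    exact h n x
  have hSH : S.topologicalClosure ≤ H2 E := by
    refine Submodule.topologicalClosure_minimal _ (Submodule.span_le.2 ?_) ?_
    · rintro _ ⟨n, x, rfl⟩
      exact monomial_mem_H2 n x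
    · rw [H2_eq]
      exact Submodule.isClosed_orthogonal _
  intro f hf
  have : CompleteSpace S.topologicalClosure :=
    S.isClosed_topologicalClosure.completeSpace_coe
  obtain ⟨p, hp, q, hq, rfl⟩ := S.topologicalClosure.exists_add_mem_mem_orthogonal f
  have hqH : q ∈ H2 E := by simpa using (H2 E).sub_mem hf (hSH hp)
  -- Membership in H² kills the negative coefficients of q, orthogonality to the monomials the
  -- others.
  have hq0 : q = 0 := by
    refine ext_fourierCoeff fun n => ?_
    rw [fourierCoeff_congr_ae (Lp.coeFn_zero E 2 m)]
    have h0 : fourierCoeff (0 : 𝕋 → E) n = 0 := by simp [fourierCoeff]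
    rw [h0]
    rcases lt_or_ge n 0 with hn | hn
    · exact hqH n hn
    · obtain ⟨k, rfl⟩ := Int.eq_ofNat_of_zero_le hn
      refine ext_inner_left ℂ fun x => ?_
      rw [← inner_monomial, inner_zero_right]
      exact (Submodule.mem_orthogonal _ _).1 hq _
        (S.le_topologicalClosure (Submodule.subset_span ⟨k, x, rfl⟩))
  rw [hq0, add_zero]
  exact hSK hp

theorem isClosed_H2 : IsClosed (H2 E : Set (L2 E)) := by
  rw [H2_eq]
  exact Submodule.isClosed_orthogonal _

theorem dense_polynomials : Dense (polynomials E : Set (H2 E)) := by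
  rw [Submodule.dense_iff_topologicalClosure_eq_top, eq_top_iff]
  rintro ⟨f, hf⟩ -
  have hcl : IsClosed (((polynomials E).topologicalClosure.map (H2 E).subtype :
      Submodule ℂ (L2 E)) : Set (L2 E)) := by
    rw [Submodule.map_coe]
    exact (isClosed_H2.isClosedEmbedding_subtypeVal).isClosedMap _
      (polynomials E).isClosed_topologicalClosure
  obtain ⟨g, hg, hgf⟩ := H2_le_of_monomial_mem hcl (fun n x =>
    ⟨⟨_, monomial_mem_H2 n x⟩, (polynomials E).le_topologicalClosure
      (Submodule.subset_span ⟨n, x, rfl⟩), rfl⟩) hf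
  have : g = ⟨f, hf⟩ := Subtype.ext hgf
  rwa [← this]

end Fourier

instance {E : Type*} [NormedAddCommGroup E] [TopologicalSpace.SeparableSpace E] :
    SecondCountableTopology (L2 E) :=
  haveI : Fact ((2 : ℝ≥0∞) ≠ ∞) := ⟨by norm_num⟩
  Lp.SecondCountableTopology

/-! ### Multiplication operators, H^∞ and inner functions -/

section Multiplication

variable {D E F : Type*} [NormedAddCommGroup D] [InnerProductSpace ℂ D]
  [NormedAddCommGroup E] [InnerProductSpace ℂ E] [NormedAddCommGroup F] [InnerProductSpace ℂ F]

/-- Essentially bounded operator functions that are measurable in the strong operator topology. -/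
structure EssBounded (Φ : 𝕋 → D →L[ℂ] E) : Prop where
  meas : ∀ x : D, AEStronglyMeasurable (fun t => Φ t x) m
  bound : ∃ C : ℝ, ∀ᵐ t ∂m, ‖Φ t‖ ≤ C

theorem EssBounded.exists_nonneg_bound {Φ : 𝕋 → D →L[ℂ] E} (hΦ : EssBounded Φ) :
    ∃ C : ℝ, 0 ≤ C ∧ ∀ᵐ t ∂m, ‖Φ t‖ ≤ C := by
  obtain ⟨C, hC⟩ := hΦ.bound
  refine ⟨max C 0, le_max_right _ _, ?_⟩
  filter_upwards [hC] with t ht using ht.trans (le_max_left _ _)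

theorem EssBounded.memLp {Φ : 𝕋 → D →L[ℂ] E} (hΦ : EssBounded Φ) {p : ℝ≥0∞} {f : 𝕋 → D}
    (hf : MemLp f p m) : MemLp (fun t => Φ t (f t)) p m := by
  obtain ⟨C, hC⟩ := hΦ.bound
  refine hf.of_le_mul (c := C) (aestronglyMeasurable_clm_apply hΦ.meas hf.1) ?_
  filter_upwards [hC] with t ht
  exact (Φ t).le_of_opNorm_le ht _

theorem EssBounded.isStrongL2 {Φ : 𝕋 → D →L[ℂ] E} (hΦ : EssBounded Φ) : IsStrongL2 Φ :=
  fun x => hΦ.memLp (memLp_const x)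

theorem EssBounded.congr {Φ Ψ : 𝕋 → D →L[ℂ] E} (hΦ : EssBounded Φ) (h : Φ =ᵐ[m] Ψ) :
    EssBounded Ψ := by
  obtain ⟨C, hC⟩ := hΦ.bound
  refine ⟨fun x => (hΦ.meas x).congr ?_, C, ?_⟩
  · filter_upwards [h] with t ht
    rw [ht]
  · filter_upwards [h, hC] with t ht h1
    rwa [← ht]

theorem EssBounded.comp {Φ : 𝕋 → D →L[ℂ] E} {Ψ : 𝕋 → F →L[ℂ] D} (hΦ : EssBounded Φ)
    (hΨ : EssBounded Ψ) : EssBounded (fun t => Φ t ∘L Ψ t) := by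
  obtain ⟨C, hC0, hC⟩ := hΦ.exists_nonneg_bound
  obtain ⟨C', hC'⟩ := hΨ.bound
  refine ⟨fun x => aestronglyMeasurable_clm_apply hΦ.meas (hΨ.meas x), C * C', ?_⟩
  filter_upwards [hC, hC'] with t h1 h2
  exact ((Φ t).opNorm_comp_le (Ψ t)).trans (by gcongr)

theorem essBounded_const (T : D →L[ℂ] E) : EssBounded (fun _ => T) :=
  ⟨fun _ => aestronglyMeasurable_const, ‖T‖, Filter.Eventually.of_forall fun _ => le_rfl⟩

theorem ae_neg {p : 𝕋 → Prop} (h : ∀ᵐ t ∂m, p t) : ∀ᵐ t ∂m, p (-t) :=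
  (Measure.measurePreserving_neg m).quasiMeasurePreserving.ae h

theorem EssBounded.flip {Φ : 𝕋 → D →L[ℂ] E} (hΦ : EssBounded Φ) : EssBounded (flip Φ) := by
  obtain ⟨C, hC⟩ := hΦ.bound
  refine ⟨fun x => ?_, C, ae_neg (p := fun t => ‖Φ t‖ ≤ C) hC⟩
  change AEStronglyMeasurable ((fun t => Φ t x) ∘ fun t => -t) m
  exact (hΦ.meas x).comp_measurePreserving (Measure.measurePreserving_neg m)

theorem EssBounded.adjoint [CompleteSpace D] [CompleteSpace E]
    [TopologicalSpace.SeparableSpace D] {Φ : 𝕋 → D →L[ℂ] E} (hΦ : EssBounded Φ) :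
    EssBounded (fun t => ContinuousLinearMap.adjoint (Φ t)) := by
  obtain ⟨C, hC⟩ := hΦ.bound
  refine ⟨aestronglyMeasurable_adjoint hΦ.meas, C, ?_⟩
  filter_upwards [hC] with t ht
  rwa [LinearIsometryEquiv.norm_map]

theorem EssBounded.tilde [CompleteSpace D] [CompleteSpace E]
    [TopologicalSpace.SeparableSpace D] {Φ : 𝕋 → D →L[ℂ] E} (hΦ : EssBounded Φ) :
    EssBounded (tilde Φ) :=
  hΦ.flip.adjoint

/-- Multiplication by an essentially bounded operator function. -/
def EssBounded.mulL {Φ : 𝕋 → D →L[ℂ] E} (hΦ : EssBounded Φ) : L2 D →L[ℂ] L2 E :=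
  LinearMap.mkContinuousOfExistsBound
    { toFun := fun f => (hΦ.memLp (Lp.memLp f)).toLp _
      map_add' := fun f g => by
        rw [← MemLp.toLp_add]
        refine MemLp.toLp_congr _ _ ?_
        filter_upwards [Lp.coeFn_add f g] with t ht
        rw [ht, Pi.add_apply, map_add]
        rfl
      map_smul' := fun c f => by
        rw [RingHom.id_apply, ← MemLp.toLp_const_smul]
        refine MemLp.toLp_congr _ _ ?_
        filter_upwards [Lp.coeFn_smul c f] with t ht
        rw [ht, Pi.smul_apply, map_smul]
        rfl } (by
    obtain ⟨C, hC⟩ := hΦ.bound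
    refine ⟨C, fun f => Lp.norm_le_mul_norm_of_ae_le_mul ?_⟩
    filter_upwards [hC, MemLp.coeFn_toLp (hΦ.memLp (Lp.memLp f))] with t ht h1
    refine (congrArg norm h1).trans_le ?_
    exact (Φ t).le_of_opNorm_le ht _)

theorem EssBounded.coeFn_mulL {Φ : 𝕋 → D →L[ℂ] E} (hΦ : EssBounded Φ) (f : L2 D) :
    hΦ.mulL f =ᵐ[m] fun t => Φ t (f t) :=
  MemLp.coeFn_toLp (hΦ.memLp (Lp.memLp f))

theorem EssBounded.mulL_mulZ {Φ : 𝕋 → D →L[ℂ] E} (hΦ : EssBounded Φ) (n : ℤ) (f : L2 D) :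
    hΦ.mulL (mulZ n f) = mulZ n (hΦ.mulL f) := by
  refine Lp.ext ?_
  filter_upwards [hΦ.coeFn_mulL (mulZ n f), hΦ.coeFn_mulL f, coeFn_mulZ n f,
    coeFn_mulZ n (hΦ.mulL f)] with t h1 h2 h3 h4
  rw [h1, h4, h3, h2, map_smul]

theorem EssBounded.coeFn_mulL_constL {Φ : 𝕋 → D →L[ℂ] E} (hΦ : EssBounded Φ) (x : D) :
    hΦ.mulL (constL D x) =ᵐ[m] fun t => Φ t x := by
  filter_upwards [hΦ.coeFn_mulL (constL D x), coeFn_constL x] with t h1 h2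
  rw [h1, h2]

theorem IsHInfty.essBounded {Φ : 𝕋 → D →L[ℂ] E} (hΦ : IsHInfty Φ) : EssBounded Φ :=
  ⟨hΦ.1, hΦ.2.1⟩

theorem EssBounded.isHInfty_iff {Φ : 𝕋 → D →L[ℂ] E} (hΦ : EssBounded Φ) :
    IsHInfty Φ ↔ ∀ x, hΦ.mulL (constL D x) ∈ H2 E := by
  have h : ∀ x n, fourierCoeff (hΦ.mulL (constL D x)) n = fourierCoeff (fun t => Φ t x) n :=
    fun x n => congrFun (fourierCoeff_congr_ae (hΦ.coeFn_mulL_constL x)) n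
  refine ⟨fun H x n hn => (h x n).trans (H.2.2 x n hn),
    fun H => ⟨hΦ.meas, hΦ.bound, fun x n hn => (h x n).symm.trans (H x n hn)⟩⟩

theorem IsHInfty.isStrongH2 {Φ : 𝕋 → D →L[ℂ] E} (hΦ : IsHInfty Φ) : IsStrongH2 Φ :=
  ⟨hΦ.essBounded.isStrongL2, hΦ.2.2⟩

theorem EssBounded.isHInfty_of_isStrongH2 {Φ : 𝕋 → D →L[ℂ] E} (hΦ : EssBounded Φ)
    (h : IsStrongH2 Φ) : IsHInfty Φ :=
  ⟨hΦ.meas, hΦ.bound, h.2⟩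

variable [CompleteSpace D] [CompleteSpace E]

/-- Multiplication by Φ is bounded and commutes with z, so it suffices to look at constants. -/
theorem IsHInfty.mulL_mem_H2 {Φ : 𝕋 → D →L[ℂ] E} (hΦ : IsHInfty Φ) {f : L2 D} (hf : f ∈ H2 D) :
    hΦ.essBounded.mulL f ∈ H2 E := by
  refine H2_le_of_monomial_mem (K := (H2 E).comap hΦ.essBounded.mulL.toLinearMap)
    (isClosed_H2.preimage hΦ.essBounded.mulL.continuous) (fun n x => ?_) hf
  change hΦ.essBounded.mulL (monomial (n : ℤ) x) ∈ H2 E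
  rw [← mulZ_constL, EssBounded.mulL_mulZ]
  exact mulZ_mem_H2 (hΦ.essBounded.isHInfty_iff.1 hΦ x) n

theorem inner_fourierCoeff {f : 𝕋 → E} (hf : Integrable f m) (x : E) (n : ℤ) :
    ⟪x, fourierCoeff f n⟫_ℂ = fourierCoeff (fun t => ⟪x, f t⟫_ℂ) n := by
  rw [fourierCoeff, fourierCoeff, ← integral_inner (hf.fourier_smul _)]
  simp [inner_smul_right]

theorem fourierCoeff_conj_neg (f : 𝕋 → ℂ) (n : ℤ) :
    fourierCoeff (fun t => (starRingEnd ℂ) (f (-t))) n = (starRingEnd ℂ) (fourierCoeff f n) := by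
  rw [fourierCoeff, fourierCoeff, ← integral_conj, ← integral_neg_eq_self]
  refine integral_congr_ae (Filter.Eventually.of_forall fun t => ?_)
  simp only [neg_neg, smul_eq_mul, map_mul, ← fourier_neg]
  congr 1
  simp only [fourier_apply]
  congr 2
  simp

/-- The negative coefficients of `Φ̃` vanish if those of `Φ` do, for `Φ̃` strongly integrable. -/
theorem fourierCoeff_tilde_eq_zero {Φ : 𝕋 → D →L[ℂ] E} (hΦ : IsStrongH2 Φ)
    (hΦ' : IsStrongL2 (tilde Φ)) (y : E) {n : ℤ} (hn : n < 0) :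
    fourierCoeff (fun t => tilde Φ t y) n = 0 := by
  refine ext_inner_left ℂ fun x => ?_
  rw [inner_fourierCoeff ((hΦ' y).integrable (by norm_num)), inner_zero_right]
  have h : (fun t => ⟪x, tilde Φ t y⟫_ℂ) = fun t => (starRingEnd ℂ) (⟪y, Φ (-t) x⟫_ℂ) := by
    ext t
    rw [inner_conj_symm, tilde, ContinuousLinearMap.adjoint_inner_right]
  rw [h, fourierCoeff_conj_neg (fun t => ⟪y, Φ t x⟫_ℂ),
    ← inner_fourierCoeff ((hΦ.1 x).integrable (by norm_num)), hΦ.2 x n hn]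
  simp

theorem IsHInfty.tilde [TopologicalSpace.SeparableSpace D] {Φ : 𝕋 → D →L[ℂ] E}
    (hΦ : IsHInfty Φ) : IsHInfty (tilde Φ) :=
  ⟨hΦ.essBounded.tilde.meas, hΦ.essBounded.tilde.bound, fun y _ hn =>
    fourierCoeff_tilde_eq_zero hΦ.isStrongH2 hΦ.essBounded.tilde.isStrongL2 y hn⟩

omit [CompleteSpace D] [CompleteSpace E] in
theorem IsInner.essBounded {Δ : 𝕋 → D →L[ℂ] E} (hΔ : IsInner Δ) : EssBounded Δ :=
  hΔ.1.essBounded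

omit [CompleteSpace D] [CompleteSpace E] in
theorem IsInner.norm_apply {Δ : 𝕋 → D →L[ℂ] E} (hΔ : IsInner Δ) :
    ∀ᵐ t ∂m, ∀ x, ‖Δ t x‖ = ‖x‖ := by
  filter_upwards [hΔ.2] with t ht
  exact (AddMonoidHomClass.isometry_iff_norm _).1 ht

theorem adjoint_comp_of_norm {T : D →L[ℂ] E} (h : ∀ x, ‖T x‖ = ‖x‖) :
    ContinuousLinearMap.adjoint T ∘L T = ContinuousLinearMap.id ℂ D :=
  (ContinuousLinearMap.norm_map_iff_adjoint_comp_self T).1 h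

theorem IsInner.adjoint_comp {Δ : 𝕋 → D →L[ℂ] E} (hΔ : IsInner Δ) :
    ∀ᵐ t ∂m, ContinuousLinearMap.adjoint (Δ t) ∘L Δ t = ContinuousLinearMap.id ℂ D := by
  filter_upwards [hΔ.norm_apply] with t ht using adjoint_comp_of_norm ht

omit [CompleteSpace D] [CompleteSpace E] in
theorem EssBounded.isInner_of_norm {Δ : 𝕋 → D →L[ℂ] E} (hΔ : EssBounded Δ)
    (h : ∀ x, hΔ.mulL (constL D x) ∈ H2 E) (hn : ∀ᵐ t ∂m, ∀ x, ‖Δ t x‖ = ‖x‖) : IsInner Δ := by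
  refine ⟨hΔ.isHInfty_iff.2 h, ?_⟩
  filter_upwards [hn] with t ht
  exact AddMonoidHomClass.isometry_of_norm _ ht

omit [CompleteSpace D] [CompleteSpace E] in
theorem IsInner.norm_mulL {Δ : 𝕋 → D →L[ℂ] E} (hΔ : IsInner Δ) (f : L2 D) :
    ‖hΔ.essBounded.mulL f‖ = ‖f‖ := by
  rw [Lp.norm_def, Lp.norm_def]
  congr 1
  refine eLpNorm_congr_norm_ae ?_
  filter_upwards [hΔ.essBounded.coeFn_mulL f, hΔ.norm_apply] with t h1 h2
  rw [h1, h2]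

omit [CompleteSpace D] [CompleteSpace E] in
theorem IsInner.isometry_mulL {Δ : 𝕋 → D →L[ℂ] E} (hΔ : IsInner Δ) :
    Isometry hΔ.essBounded.mulL :=
  AddMonoidHomClass.isometry_of_norm _ hΔ.norm_mulL

end Multiplication

/-! ### Wandering subspaces and the Beurling–Lax–Halmos theorem -/

section Wandering

variable {E : Type u} [NormedAddCommGroup E] [InnerProductSpace ℂ E] [CompleteSpace E]

/-- The wandering subspace `M ⊖ zM`. -/
def wandering (M : Submodule ℂ (L2 E)) : Submodule ℂ (L2 E) :=
  M ⊓ (M.map (mulZ (E := E) 1).toLinearMap)ᗮ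

variable {M : Submodule ℂ (L2 E)}

omit [CompleteSpace E] in
theorem mulZ_mem_of_shift_invariant (hS : ∀ f ∈ M, mulZ 1 f ∈ M) {f : L2 E} (hf : f ∈ M) (n : ℕ) :
    mulZ n f ∈ M := by
  induction n with
  | zero => simpa using hf
  | succ n ih =>
    have := hS _ ih
    rwa [mulZ_mulZ, add_comm, ← Nat.cast_succ] at this

theorem isClosed_map_mulZ (hM : IsClosed (M : Set (L2 E))) (n : ℤ) :
    IsClosed ((M.map (mulZ (E := E) n).toLinearMap : Submodule ℂ (L2 E)) : Set (L2 E)) :=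
  (mulZ (E := E) n).isometry.isClosedEmbedding.isClosedMap _ hM

omit [CompleteSpace E] in
theorem isClosed_wandering (hM : IsClosed (M : Set (L2 E))) :
    IsClosed (wandering M : Set (L2 E)) :=
  hM.inter (Submodule.isClosed_orthogonal _)

-- For n > 0, zⁿx lies in zM, to which y is orthogonal; for n < 0 the roles of x and y are
-- exchanged.
omit [CompleteSpace E] in
theorem inner_mulZ_eq_zero_of_wandering (hS : ∀ f ∈ M, mulZ 1 f ∈ M) {x y : L2 E}
    (hx : x ∈ wandering M) (hy : y ∈ wandering M) {n : ℤ} (hn : n ≠ 0) :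
    ⟪mulZ n x, y⟫_ℂ = 0 := by
  have key : ∀ {a b : L2 E}, a ∈ wandering M → b ∈ wandering M → ∀ k : ℕ,
      ⟪mulZ (k + 1 : ℕ) a, b⟫_ℂ = 0 := fun {a b} ha hb k => by
    refine (Submodule.mem_orthogonal _ _).1 hb.2 _ ⟨mulZ k a,
      mulZ_mem_of_shift_invariant hS ha.1 k, ?_⟩
    change mulZ 1 (mulZ k a) = _
    rw [mulZ_mulZ, Nat.cast_succ, add_comm]
  rcases lt_or_gt_of_ne hn with h | h
  · obtain ⟨k, hk⟩ := Int.eq_ofNat_of_zero_le (show 0 ≤ -n - 1 by omega)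
    rw [inner_mulZ_left, ← inner_conj_symm, show -n = ((k + 1 : ℕ) : ℤ) by omega, key hy hx,
      map_zero]
  · obtain ⟨k, hk⟩ := Int.eq_ofNat_of_zero_le (show 0 ≤ n - 1 by omega)
    rw [show n = ((k + 1 : ℕ) : ℤ) by omega, key hx hy]

omit [CompleteSpace E] in
/-- For `x, y` in the wandering subspace, `⟪x(t), y(t)⟫` is constant. -/
theorem inner_ae_eq_of_wandering (hS : ∀ f ∈ M, mulZ 1 f ∈ M) {x y : L2 E}
    (hx : x ∈ wandering M) (hy : y ∈ wandering M) : ∀ᵐ t ∂m, ⟪x t, y t⟫_ℂ = ⟪x, y⟫_ℂ := by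
  -- The n-th coefficient of ⟪x(t), y(t)⟫ is ⟪zⁿx, y⟫, so only n = 0 survives.
  have h : (fun t => ⟪x t, y t⟫_ℂ - ⟪x, y⟫_ℂ) =ᵐ[m] 0 := by
    refine ae_eq_zero_of_fourierCoeff_eq_zero
      ((integrable_inner_L2 x y).sub (integrable_const _)) fun n => ?_
    have h1 : fourierCoeff (fun t => ⟪x t, y t⟫_ℂ - ⟪x, y⟫_ℂ) n
        = fourierCoeff (fun t => ⟪x t, y t⟫_ℂ) n - fourierCoeff (fun _ : 𝕋 => ⟪x, y⟫_ℂ) n := by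
      simp only [fourierCoeff, smul_sub]
      exact integral_sub ((integrable_inner_L2 x y).fourier_smul _)
        ((integrable_const _).fourier_smul _)
    have h2 : fourierCoeff (fun _ : 𝕋 => ⟪x, y⟫_ℂ) n = if n = 0 then ⟪x, y⟫_ℂ else 0 := by
      have h3 : (fun _ : 𝕋 => ⟪x, y⟫_ℂ) = ⟪x, y⟫_ℂ • (fourier 0 : 𝕋 → ℂ) := by
        ext t
        simp
      rw [h3, fourierCoeff.const_smul, fourierCoeff_fourier]
      by_cases hn : n = 0 <;> simp [hn]
    rw [h1, h2, fourierCoeff_inner]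
    split_ifs with hn
    · simp [hn]
    · rw [inner_mulZ_eq_zero_of_wandering hS hx hy hn, sub_zero]
  filter_upwards [h] with t ht
  exact sub_eq_zero.1 ht

/-- A vector of a shift-invariant `M ⊆ H²` orthogonal to all `zⁿ x`, `x ∈ M ⊖ zM`, vanishes. -/
theorem eq_zero_of_orthogonal_wandering (hM : IsClosed (M : Set (L2 E))) (hH : M ≤ H2 E)
    (hS : ∀ f ∈ M, mulZ 1 f ∈ M) {q : L2 E} (hq : q ∈ M)
    (h : ∀ (n : ℕ), ∀ x ∈ wandering M, ⟪mulZ n x, q⟫_ℂ = 0) : q = 0 := by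
  -- q can be divided by z indefinitely: the part b of z⁻ⁿq orthogonal to zM is wandering, and 0 =
  -- ⟪zⁿb, q⟫ = ⟪b, z⁻ⁿq⟫ = ‖b‖².
  have hmem : ∀ n : ℕ, mulZ (-n) q ∈ M := by
    intro n
    induction n with
    | zero => simpa using hq
    | succ n ih =>
      have hcl := isClosed_map_mulZ hM 1
      have : CompleteSpace (M.map (mulZ (E := E) 1).toLinearMap) := hcl.completeSpace_coe
      obtain ⟨a, ha, b, hb, hab⟩ :=
        (M.map (mulZ (E := E) 1).toLinearMap).exists_add_mem_mem_orthogonal (mulZ (-n) q)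
      have haM : a ∈ M := by
        obtain ⟨c, hc, rfl⟩ := ha
        exact hS c hc
      have hbM : b ∈ M := by
        rw [← add_sub_cancel_left a b, ← hab]
        exact M.sub_mem ih haM
      have hb0 : b = 0 := by
        have h1 := h n b ⟨hbM, hb⟩
        rw [inner_mulZ_left, hab, inner_add_right,
          (Submodule.mem_orthogonal' _ _).1 hb a ha, zero_add] at h1
        exact inner_self_eq_zero.1 h1
      obtain ⟨c, hc, hca⟩ := ha
      have : mulZ (-(n + 1 : ℕ)) q = c := by
        rw [show -((n + 1 : ℕ) : ℤ) = -1 + -n by push_cast; ring, ← mulZ_mulZ, hab, hb0, add_zero,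
          ← hca]
        change mulZ (-1) (mulZ 1 c) = c
        rw [mulZ_mulZ, neg_add_cancel, mulZ_zero]
      rw [this]
      exact hc
  refine ext_fourierCoeff fun k => ?_
  -- Dividing by a power of z exceeding k moves the k-th coefficient of q to a negative index, where
  -- H² forces zero.
  have h1 := hH (hmem (k.toNat + 1)) (k - (k.toNat + 1 : ℕ)) (by omega)
  rw [fourierCoeff_mulZ, sub_neg_eq_add, sub_add_cancel] at h1
  rw [h1, fourierCoeff_congr_ae (Lp.coeFn_zero E 2 m)]
  simp [fourierCoeff]

variable [TopologicalSpace.SeparableSpace E]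

/-- Inner products in the wandering subspace are constant pointwise, so an orthonormal basis of it
is orthonormal in E at almost every t. Evaluation at t therefore defines an isometry into E, and the
wandering subspace itself serves as the initial space. -/
theorem exists_norm_preserving_of_wandering (hM : IsClosed (M : Set (L2 E)))
    (hS : ∀ f ∈ M, mulZ 1 f ∈ M) :
    ∃ (Δ : 𝕋 → wandering M →L[ℂ] E) (hΔ : EssBounded Δ),
      (∀ᵐ t ∂m, ∀ x, ‖Δ t x‖ = ‖x‖) ∧ ∀ x, hΔ.mulL (constL _ x) = x := by
  classical
  have : CompleteSpace (wandering M) := (isClosed_wandering hM).completeSpace_coe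
  obtain ⟨ι, b, -⟩ := exists_hilbertBasis ℂ (wandering M)
  have : Countable ι := b.orthonormal.countable_of_separable
  have hon : ∀ᵐ t ∂m, Orthonormal ℂ (fun i => ((b i : wandering M) : L2 E) t) := by
    have : ∀ᵐ t ∂m, ∀ i j, ⟪((b i : wandering M) : L2 E) t, ((b j : wandering M) : L2 E) t⟫_ℂ
        = if i = j then 1 else 0 := by
      refine ae_all_iff.2 fun i => ae_all_iff.2 fun j => ?_
      filter_upwards [inner_ae_eq_of_wandering hS (b i).2 (b j).2] with t ht
      rw [ht, ← orthonormal_iff_ite.1 b.orthonormal i j]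
      rfl
    filter_upwards [this] with t ht
    exact orthonormal_iff_ite.2 ht
  -- The value 0 is taken only on the null set where orthonormality fails.
  let Δ : 𝕋 → wandering M →L[ℂ] E := fun t =>
    if h : Orthonormal ℂ (fun i => ((b i : wandering M) : L2 E) t) then
      (h.orthogonalFamily.linearIsometry.comp b.repr.toLinearIsometry).toContinuousLinearMap
    else 0
  have hΔt : ∀ t (h : Orthonormal ℂ (fun i => ((b i : wandering M) : L2 E) t)) (x : wandering M),
      Δ t x = h.orthogonalFamily.linearIsometry (b.repr x) := by
    intro t h x
    simp only [Δ, dif_pos h]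
    rfl
  have hnorm : ∀ᵐ t ∂m, ∀ x, ‖Δ t x‖ = ‖x‖ := by
    filter_upwards [hon] with t ht x
    rw [hΔt t ht, LinearIsometry.norm_map, LinearIsometryEquiv.norm_map]
  have hsum : ∀ᵐ t ∂m, ∀ x, HasSum (fun i => b.repr x i • ((b i : wandering M) : L2 E) t)
      (Δ t x) := by
    filter_upwards [hon] with t ht x
    rw [hΔt t ht]
    exact ht.orthogonalFamily.hasSum_linearIsometry (b.repr x)
  have hmeas : ∀ x, AEStronglyMeasurable (fun t => Δ t x) m := by
    intro x
    refine aestronglyMeasurable_of_tendsto_ae (Filter.atTop : Filter (Finset ι))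
      (f := fun s t => ∑ i ∈ s, b.repr x i • ((b i : wandering M) : L2 E) t) (fun s => ?_) ?_
    · exact Finset.aestronglyMeasurable_fun_sum s fun i _ =>
        (Lp.aestronglyMeasurable _).const_smul _
    · filter_upwards [hsum] with t ht
      exact ht x
  have hΔ : EssBounded Δ := by
    refine ⟨hmeas, 1, ?_⟩
    filter_upwards [hnorm] with t ht
    exact ContinuousLinearMap.opNorm_le_bound _ zero_le_one fun x => by rw [ht, one_mul]
  refine ⟨Δ, hΔ, hnorm, fun x => ?_⟩
  have hdense : Dense (Submodule.span ℂ (Set.range b) : Set (wandering M)) :=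
    Submodule.dense_iff_topologicalClosure_eq_top.2 b.dense_span
  have heq : hΔ.mulL.comp (constL (wandering M)) = (wandering M).subtypeL := by
    refine ContinuousLinearMap.ext_on hdense ?_
    rintro _ ⟨i, rfl⟩
    refine Lp.ext ?_
    filter_upwards [hΔ.coeFn_mulL_constL (b i), hsum] with t h1 h2
    change (hΔ.mulL (constL _ (b i))) t = ((b i : wandering M) : L2 E) t
    rw [h1]
    refine (h2 (b i)).unique ?_
    have : (fun j => b.repr (b i) j • ((b j : wandering M) : L2 E) t)
        = fun j => if j = i then ((b i : wandering M) : L2 E) t else 0 := by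
      ext j
      rw [b.repr_self, lp.single_apply]
      by_cases hj : j = i
      · subst hj
        simp
      · simp [hj]
    rw [this]
    exact hasSum_ite_eq i _
  exact congrArg (fun T => T x) heq

/-- The Beurling–Lax–Halmos theorem. -/
theorem exists_inner_of_shift_invariant (hM : IsClosed (M : Set (L2 E))) (hH : M ≤ H2 E)
    (hS : ∀ f ∈ M, mulZ 1 f ∈ M) :
    ∃ (E' : Type u) (_ : NormedAddCommGroup E') (_ : InnerProductSpace ℂ E')
      (_ : CompleteSpace E') (_ : TopologicalSpace.SeparableSpace E') (Δ : 𝕋 → E' →L[ℂ] E)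
      (hΔ : IsInner Δ), ∀ f, f ∈ M ↔ ∃ g ∈ H2 E', hΔ.essBounded.mulL g = f := by
  have : CompleteSpace (wandering M) := (isClosed_wandering hM).completeSpace_coe
  obtain ⟨Δ, hb, hnorm, hconst⟩ := exists_norm_preserving_of_wandering hM hS
  have hΔ : IsInner Δ := hb.isInner_of_norm (fun x => by
    rw [hconst]
    exact hH x.2.1) hnorm
  refine ⟨wandering M, inferInstance, inferInstance, inferInstance, inferInstance, Δ, hΔ, ?_⟩
  let R : Submodule ℂ (L2 E) := (H2 (wandering M)).map hΔ.essBounded.mulL.toLinearMap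
  have hRcl : IsClosed (R : Set (L2 E)) :=
    hΔ.isometry_mulL.isClosedEmbedding.isClosedMap _ isClosed_H2
  have hRM : R ≤ M := by
    rw [Submodule.map_le_iff_le_comap]
    refine H2_le_of_monomial_mem (hM.preimage hΔ.essBounded.mulL.continuous) fun n x => ?_
    change hΔ.essBounded.mulL (monomial (n : ℤ) x) ∈ M
    rw [← mulZ_constL, EssBounded.mulL_mulZ, hconst]
    exact mulZ_mem_of_shift_invariant hS x.2.1 n
  have hMR : M ≤ R := by
    intro f hf
    have : CompleteSpace R := hRcl.completeSpace_coe
    obtain ⟨p, hp, q, hq, rfl⟩ := R.exists_add_mem_mem_orthogonal f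
    have hqM : q ∈ M := by simpa using M.sub_mem hf (hRM hp)
    have hq0 : q = 0 := by
      refine eq_zero_of_orthogonal_wandering hM hH hS hqM fun n x hx => ?_
      refine (Submodule.mem_orthogonal _ _).1 hq _ ⟨monomial n ⟨x, hx⟩, monomial_mem_H2 n _, ?_⟩
      change hΔ.essBounded.mulL (monomial (n : ℤ) ⟨x, hx⟩) = _
      rw [← mulZ_constL, EssBounded.mulL_mulZ, hconst]
    rw [hq0, add_zero]
    exact hp
  intro f
  exact ⟨fun hf => hMR hf, fun hf => hRM hf⟩

end Wandering

/-! ### The analytic kernel, the Hankel operator and the backward-shift span -/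

section Kernel

variable {D E : Type*} [NormedAddCommGroup D] [InnerProductSpace ℂ D]
  [NormedAddCommGroup E] [InnerProductSpace ℂ E]

/-- The space of all `f ∈ H²_E` such that `Φ^* f` is analytic, in the weak sense. -/
def analyticKernel {Φ : 𝕋 → D →L[ℂ] E} (hΦ : IsStrongL2 Φ) : Submodule ℂ (L2 E) :=
  H2 E ⊓ (Submodule.span ℂ
    {g | ∃ (n : ℕ) (x : D), g = mulZ (-(n + 1 : ℕ) : ℤ) ((hΦ x).toLp _)})ᗮ

variable {Φ : 𝕋 → D →L[ℂ] E} {hΦ : IsStrongL2 Φ}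

/-- The pairing is the (n+1)-st coefficient of ⟪f, Φx⟫, the conjugate of that of ⟪x, Φ^*f⟫ at
-(n+1). Testing weakly avoids the product Φ^*f, which need not be square integrable. -/
theorem mem_analyticKernel {f : L2 E} : f ∈ analyticKernel hΦ ↔
    f ∈ H2 E ∧ ∀ (n : ℕ) (x : D), ⟪mulZ (n + 1 : ℕ) f, (hΦ x).toLp _⟫_ℂ = 0 := by
  refine and_congr_right fun _ => ?_
  have hflip : ∀ (n : ℕ) (x : D), ⟪mulZ (-(n + 1 : ℕ) : ℤ) ((hΦ x).toLp _), f⟫_ℂ = 0 ↔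
      ⟪mulZ (n + 1 : ℕ) f, (hΦ x).toLp _⟫_ℂ = 0 := fun n x => by
    rw [inner_mulZ_left, neg_neg, inner_eq_zero_symm]
  constructor
  · intro h n x
    rw [← hflip]
    exact (Submodule.mem_orthogonal _ _).1 h _ (Submodule.subset_span ⟨n, x, rfl⟩)
  · intro h
    refine (Submodule.mem_orthogonal _ _).2 fun g hg => ?_
    induction hg using Submodule.span_induction with
    | mem g hg =>
      obtain ⟨n, x, rfl⟩ := hg
      exact (hflip n x).2 (h n x)
    | zero => exact inner_zero_left _
    | add a b _ _ ha hb => rw [inner_add_left, ha, hb, add_zero]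
    | smul c a _ ha => rw [inner_smul_left, ha, mul_zero]

theorem mulZ_mem_analyticKernel {f : L2 E} (hf : f ∈ analyticKernel hΦ) :
    mulZ 1 f ∈ analyticKernel hΦ := by
  rw [mem_analyticKernel] at hf ⊢
  refine ⟨mulZ_mem_H2 hf.1 1, fun n x => ?_⟩
  rw [mulZ_mulZ]
  exact hf.2 (n + 1) x

variable [CompleteSpace E]

theorem isClosed_analyticKernel : IsClosed (analyticKernel hΦ : Set (L2 E)) :=
  isClosed_H2.inter (Submodule.isClosed_orthogonal _)

theorem J_J (f : L2 E) : J E (J E f) = f :=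
  ext_fourierCoeff fun n => by
    rw [fourierCoeff_J, fourierCoeff_J]
    congr 1
    ring

theorem inner_J_left (f g : L2 E) : ⟪J E f, g⟫_ℂ = ⟪f, J E g⟫_ℂ := by
  rw [← (J E).inner_map_map, J_J]

theorem J_mem_orthogonal {f : L2 E} (hf : f ∈ H2 E) : J E f ∈ (H2 E)ᗮ := by
  rw [Submodule.mem_orthogonal]
  intro h hh
  have : H2 E ≤ (Submodule.span ℂ {J E f})ᗮ := by
    refine H2_le_of_monomial_mem (Submodule.isClosed_orthogonal _) fun n x => ?_
    rw [Submodule.mem_orthogonal_singleton_iff_inner_left, inner_monomial, fourierCoeff_J,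
      hf _ (by omega), inner_zero_right]
  exact Submodule.mem_orthogonal_singleton_iff_inner_left.1 (this hh)

variable [CompleteSpace D]

/-- J is symmetric and sends f into the complement of H², where P₋ is the identity, so the
projection drops out. -/
theorem inner_hankel {Ψ : 𝕋 → D →L[ℂ] E} (hΨ : IsStrongL2 Ψ) (f : H2 E)
    (p : (hankel hΨ).domain) :
    ⟪f, hankel hΨ p⟫_ℂ = ⟪(f : L2 E), J E (mulPolynomial hΨ p)⟫_ℂ := by
  change ⟪(f : L2 E), J E ((H2 E)ᗮ.starProjection (mulPolynomial hΨ p))⟫_ℂ = _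
  rw [← inner_J_left, ← inner_J_left, ← Submodule.inner_starProjection_left_eq_right,
    Submodule.starProjection_eq_self_iff.2 (J_mem_orthogonal f.2)]

/-- The flip in J undoes the flip of Φ and contributes one extra z̄; hence the exponent n + 1. -/
theorem J_mulPolynomial_flip (hΦ : IsStrongL2 Φ) (p : polynomials D) {n : ℕ} {x : D}
    (hp : ((p : H2 D) : L2 D) = monomial (n : ℤ) x) :
    J E (mulPolynomial hΦ.flip p) = mulZ (-(n + 1 : ℕ) : ℤ) ((hΦ x).toLp _) := by
  have h1 : ∀ᵐ t ∂m, (mulPolynomial hΦ.flip p : L2 E) t = Φ (-t) (((p : H2 D) : L2 D) t) :=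
    MemLp.coeFn_toLp (memLp_apply_polynomial hΦ.flip p)
  have h2 : ∀ᵐ t ∂m, ((p : H2 D) : L2 D) t = fourier (n : ℤ) t • x := by
    rw [hp]
    exact coeFn_monomial (n : ℤ) x
  refine Lp.ext ?_
  filter_upwards [coeFn_J (mulPolynomial hΦ.flip p), ae_neg h1, ae_neg h2,
    coeFn_mulZ (-(n + 1 : ℕ) : ℤ) ((hΦ x).toLp _), MemLp.coeFn_toLp (hΦ x)] with t h3 h4 h5 h6 h7
  rw [h3, h4, h5, h6, h7, neg_neg, map_smul, smul_smul]
  congr 1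
  simp only [fourier_apply, ← Circle.coe_mul, ← toCircle_add]
  congr 2
  push_cast
  module

theorem linearMap_eq_zero_of_monomial {L : polynomials D →ₗ[ℂ] ℂ}
    (h : ∀ (p : polynomials D) (n : ℕ) (x : D), ((p : H2 D) : L2 D) = monomial (n : ℤ) x → L p = 0) :
    L = 0 := by
  have hle : polynomials D ≤ (LinearMap.ker L).map (polynomials D).subtype := by
    refine Submodule.span_le.2 ?_
    rintro p ⟨n, x, hp⟩
    have hmem : p ∈ polynomials D := Submodule.subset_span ⟨n, x, hp⟩
    exact ⟨⟨p, hmem⟩, h ⟨p, hmem⟩ n x hp, rfl⟩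
  ext p
  obtain ⟨q, hq, hqp⟩ := hle p.2
  rw [← Subtype.ext hqp]
  exact hq

/-- The kernel of the adjoint is the orthogonal complement of the range, and on monomials
orthogonality is the defining condition of the analytic kernel. -/
theorem mem_kerHankelAdjoint_flip (hΦ : IsStrongL2 Φ) (f : H2 E) :
    f ∈ kerHankelAdjoint hΦ.flip ↔ (f : L2 E) ∈ analyticKernel hΦ := by
  have hd : Dense ((hankel hΦ.flip).domain : Set (H2 D)) := dense_polynomials
  have h1 : f ∈ kerHankelAdjoint hΦ.flip ↔
      ∀ p : (hankel hΦ.flip).domain, ⟪f, hankel hΦ.flip p⟫_ℂ = 0 := by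
    constructor
    · rintro ⟨hf, h⟩ p
      rw [← LinearPMap.adjoint_isFormalAdjoint hd ⟨f, hf⟩ p, h, inner_zero_left]
    · intro h
      have hf : f ∈ (hankel hΦ.flip).adjoint.domain :=
        LinearPMap.mem_adjoint_domain_of_exists _ ⟨0, fun p => by rw [h, inner_zero_left]⟩
      exact ⟨hf, LinearPMap.adjoint_apply_eq hd _ fun p => by rw [h, inner_zero_left]⟩
  rw [h1, mem_analyticKernel]
  simp only [inner_hankel]
  constructor
  · intro h
    refine ⟨f.2, fun n x => ?_⟩
    let p : polynomials D := ⟨⟨_, monomial_mem_H2 n x⟩, Submodule.subset_span ⟨n, x, rfl⟩⟩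
    have hp : ⟪(f : L2 E), J E (mulPolynomial hΦ.flip p)⟫_ℂ = 0 := h p
    rwa [J_mulPolynomial_flip hΦ p (n := n) (x := x) rfl, ← inner_mulZ_left] at hp
  · rintro ⟨-, h⟩ p
    have h0 : (innerₛₗ ℂ (f : L2 E)) ∘ₗ (J E).toLinearMap ∘ₗ mulPolynomial hΦ.flip = 0 := by
      refine linearMap_eq_zero_of_monomial fun p n x hp => ?_
      change ⟪(f : L2 E), J E (mulPolynomial hΦ.flip p)⟫_ℂ = 0
      rw [J_mulPolynomial_flip hΦ p hp, ← inner_mulZ_left, h]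
    exact congrArg (fun T => T p) h0

omit [CompleteSpace E] [CompleteSpace D] in
/-- The linear map `x ↦ Φ(·)x`. -/
def IsStrongL2.toLin (hΦ : IsStrongL2 Φ) : D →ₗ[ℂ] L2 E where
  toFun x := (hΦ x).toLp _
  map_add' x y := by
    rw [← MemLp.toLp_add]
    exact MemLp.toLp_congr _ _ (Filter.Eventually.of_forall fun t => map_add _ _ _)
  map_smul' c x := by
    rw [RingHom.id_apply, ← MemLp.toLp_const_smul]
    exact MemLp.toLp_congr _ _ (Filter.Eventually.of_forall fun t => map_smul _ _ _)

/-- The map `x ↦ Φ(·)x` is bounded, by the closed graph theorem. -/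
def IsStrongL2.toL (hΦ : IsStrongL2 Φ) : D →L[ℂ] L2 E where
  toLinearMap := hΦ.toLin
  cont := by
    refine LinearMap.continuous_of_seq_closed_graph hΦ.toLin fun u x y hu hy => ?_
    -- Along a subsequence the L² limit is an a.e. limit, which continuity of each Φ(t) identifies.
    obtain ⟨ns, hns, hlim⟩ := (tendstoInMeasure_of_tendsto_Lp hy).exists_seq_tendsto_ae
    have hall : ∀ᵐ t ∂m, ∀ k, (hΦ.toLin (u k)) t = Φ t (u k) :=
      ae_all_iff.2 fun k => MemLp.coeFn_toLp (hΦ (u k))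
    refine Lp.ext ?_
    filter_upwards [hlim, hall, MemLp.coeFn_toLp (hΦ x)] with t h1 h2 h3
    have h4 : Filter.Tendsto (fun i => Φ t (u (ns i))) Filter.atTop (nhds (Φ t x)) :=
      ((Φ t).continuous.tendsto x).comp (hu.comp hns.tendsto_atTop)
    refine (tendsto_nhds_unique h1 (h4.congr fun i => ?_)).trans h3.symm
    exact (h2 (ns i)).symm

omit [CompleteSpace D] in
theorem mem_orthogonal_backwardSpan {F : Set (H2 E)} {g : H2 E} :
    g ∈ (backwardSpan F)ᗮ ↔ ∀ n : ℕ, ∀ f ∈ F, ⟪mulZ (n : ℤ) (g : L2 E), (f : L2 E)⟫_ℂ = 0 := by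
  have hpow : ∀ n : ℕ, (((shift E) ^ n) g : H2 E) = (mulZ (n : ℤ) (g : L2 E) : L2 E) := by
    intro n
    induction n with
    | zero => simp
    | succ n ih =>
      rw [pow_succ', mul_apply_eq_comp]
      change mulZ 1 ((((shift E) ^ n) g : H2 E) : L2 E) = _
      rw [ih, mulZ_mulZ, Nat.cast_succ, add_comm]
  have hadj : ∀ (n : ℕ) (f : H2 E), ⟪((ContinuousLinearMap.adjoint (shift E)) ^ n) f, g⟫_ℂ = 0 ↔
      ⟪mulZ (n : ℤ) (g : L2 E), (f : L2 E)⟫_ℂ = 0 := by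
    intro n f
    have h1 : (ContinuousLinearMap.adjoint (shift E)) ^ n
        = ContinuousLinearMap.adjoint ((shift E) ^ n) := by
      rw [← ContinuousLinearMap.star_eq_adjoint, ← ContinuousLinearMap.star_eq_adjoint, star_pow]
    rw [h1, ContinuousLinearMap.adjoint_inner_left, inner_eq_zero_symm, ← hpow]
    rfl
  rw [backwardSpan, Submodule.orthogonal_closure]
  constructor
  · intro h n f hf
    rw [← hadj]
    exact (Submodule.mem_orthogonal _ _).1 h _ (Submodule.subset_span ⟨n, f, hf, rfl⟩)
  · intro h
    rw [Submodule.mem_orthogonal]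
    intro u hu
    induction hu using Submodule.span_induction with
    | mem u hu =>
      obtain ⟨n, f, hf, rfl⟩ := hu
      exact (hadj n f).2 (h n f hf)
    | zero => exact inner_zero_left _
    | add a b _ _ ha hb => rw [inner_add_left, ha, hb, add_zero]
    | smul c a _ ha => rw [inner_smul_left, ha, mul_zero]

/-- P₊ drops out because zⁿg ∈ H², and boundedness of x ↦ Φ(·)x passes from basis vectors to all x.
So the space does not depend on the basis. -/
theorem mem_orthogonal_backwardSpan_columns {ι : Type*} (b : HilbertBasis ι ℂ D)
    (hΦ : IsStrongL2 Φ) {g : H2 E} :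
    g ∈ (backwardSpan (analyticColumns b hΦ))ᗮ ↔
      ∀ (n : ℕ) (x : D), ⟪mulZ (n : ℤ) (g : L2 E), (hΦ x).toLp _⟫_ℂ = 0 := by
  have hproj : ∀ (n : ℕ) (f : L2 E),
      ⟪mulZ (n : ℤ) (g : L2 E), ((H2 E).orthogonalProjectionOnto f : L2 E)⟫_ℂ
        = ⟪mulZ (n : ℤ) (g : L2 E), f⟫_ℂ := fun n f =>
    Submodule.inner_orthogonalProjectionOnto_eq_of_mem_left
      (⟨_, mulZ_mem_H2 g.2 n⟩ : H2 E) f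
  rw [mem_orthogonal_backwardSpan]
  constructor
  · intro h n x
    have h0 : (innerSL ℂ (mulZ (n : ℤ) (g : L2 E))).comp hΦ.toL = 0 := by
      refine ContinuousLinearMap.ext_on
        (Submodule.dense_iff_topologicalClosure_eq_top.2 b.dense_span) ?_
      rintro _ ⟨k, rfl⟩
      have := h n _ ⟨k, rfl⟩
      rwa [hproj] at this
    exact congrArg (fun T => T x) h0
  · rintro h n _ ⟨k, rfl⟩
    rw [hproj, h]

/-- The complement of the backward span tests exponents n ≥ 0, the analytic kernel K only n ≥ 1.
Together with the next lemma this places the complement between zK and K. -/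
theorem mem_analyticKernel_of_mem_orthogonal {ι : Type*} (b : HilbertBasis ι ℂ D)
    (hΦ : IsStrongL2 Φ) {g : H2 E} (hg : g ∈ (backwardSpan (analyticColumns b hΦ))ᗮ) :
    (g : L2 E) ∈ analyticKernel hΦ :=
  mem_analyticKernel.2 ⟨g.2, fun n x =>
    (mem_orthogonal_backwardSpan_columns b hΦ).1 hg (n + 1) x⟩

theorem shift_mem_orthogonal_of_mem_analyticKernel {ι : Type*} (b : HilbertBasis ι ℂ D)
    (hΦ : IsStrongL2 Φ) {g : H2 E} (hg : (g : L2 E) ∈ analyticKernel hΦ) :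
    shift E g ∈ (backwardSpan (analyticColumns b hΦ))ᗮ := by
  rw [mem_orthogonal_backwardSpan_columns]
  intro n x
  change ⟪mulZ (n : ℤ) (mulZ 1 (g : L2 E)), _⟫_ℂ = 0
  rw [mulZ_mulZ]
  exact (mem_analyticKernel.1 hg).2 n x

end Kernel

/-! ### Point evaluation on the disc and generic independence of columns -/

section Evaluation

variable {D E F : Type*} [NormedAddCommGroup D] [InnerProductSpace ℂ D] [CompleteSpace D]
  [NormedAddCommGroup E] [InnerProductSpace ℂ E] [CompleteSpace E]
  [NormedAddCommGroup F] [InnerProductSpace ℂ F] [CompleteSpace F]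

omit [CompleteSpace E] in
theorem norm_monomial_le (n : ℤ) (x : E) : ‖monomial n x‖ ≤ ‖x‖ := by
  rw [← mulZ_constL, LinearIsometry.norm_map]
  exact ((constL E).le_of_opNorm_le (LinearMap.mkContinuous_norm_le _ zero_le_one _) x).trans_eq
    (one_mul _)

theorem norm_fourierCoeff_le (f : L2 E) (n : ℤ) : ‖fourierCoeff f n‖ ≤ ‖f‖ := by
  have h1 : ‖fourierCoeff f n‖ * ‖fourierCoeff f n‖ ≤ ‖fourierCoeff f n‖ * ‖f‖ := by
    have h2 := inner_monomial n (fourierCoeff f n) f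
    rw [inner_self_eq_norm_sq_to_K] at h2
    have h3 : ‖fourierCoeff f n‖ ^ 2 ≤ ‖monomial n (fourierCoeff f n)‖ * ‖f‖ := by
      refine le_trans (le_of_eq ?_) (norm_inner_le_norm (𝕜 := ℂ) _ _)
      rw [h2]
      simp
    rw [← sq]
    exact h3.trans (by gcongr; exact norm_monomial_le _ _)
  rcases (norm_nonneg (fourierCoeff f n)).eq_or_lt with h | h
  · rw [← h]
    exact norm_nonneg _
  · exact le_of_mul_le_mul_left h1 h

omit [CompleteSpace E] in
theorem fourierCoeff_add (f g : L2 E) (n : ℤ) :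
    fourierCoeff (f + g : L2 E) n = fourierCoeff f n + fourierCoeff g n := by
  rw [fourierCoeff_congr_ae (Lp.coeFn_add f g),
    fourierCoeff.add (integrable_L2 f) (integrable_L2 g), Pi.add_apply]

omit [CompleteSpace E] in
theorem fourierCoeff_smul (c : ℂ) (f : L2 E) (n : ℤ) :
    fourierCoeff (c • f : L2 E) n = c • fourierCoeff f n := by
  rw [fourierCoeff_congr_ae (Lp.coeFn_smul c f)]
  exact fourierCoeff.const_smul _ _ _

theorem norm_pow_smul_fourierCoeff_le (ζ : ℂ) (g : L2 E) (n : ℕ) :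
    ‖ζ ^ n • fourierCoeff g (n : ℤ)‖ ≤ ‖ζ‖ ^ n * ‖g‖ := by
  rw [norm_smul, norm_pow]
  gcongr
  exact norm_fourierCoeff_le _ _

theorem summable_evalDisc {ζ : ℂ} (hζ : ‖ζ‖ < 1) (g : L2 E) :
    Summable fun n : ℕ => ζ ^ n • fourierCoeff g (n : ℤ) :=
  Summable.of_norm_bounded ((summable_geometric_of_lt_one (norm_nonneg _) hζ).mul_right _)
    (norm_pow_smul_fourierCoeff_le ζ g)

variable (E) in
/-- Evaluation of functions in `H²_E` at a point of the unit disc. -/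
def evalL {ζ : ℂ} (hζ : ‖ζ‖ < 1) : H2 E →L[ℂ] E :=
  LinearMap.mkContinuous
    { toFun := evalDisc ζ
      map_add' := fun f g => by
        rw [evalDisc, evalDisc, evalDisc,
          ← (summable_evalDisc hζ _).tsum_add (summable_evalDisc hζ _)]
        simp only [Submodule.coe_add, fourierCoeff_add, smul_add]
      map_smul' := fun c f => by
        rw [evalDisc, RingHom.id_apply, evalDisc, ← (summable_evalDisc hζ _).tsum_const_smul]
        simp only [Submodule.coe_smul, fourierCoeff_smul, smul_comm c] } (∑' n : ℕ, ‖ζ‖ ^ n)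
    (fun f => by
      have hs := summable_geometric_of_lt_one (norm_nonneg _) hζ
      rw [← hs.tsum_mul_right]
      exact tsum_of_norm_bounded (hs.mul_right _).hasSum (norm_pow_smul_fourierCoeff_le ζ (f : L2 E)))

theorem evalL_apply {ζ : ℂ} (hζ : ‖ζ‖ < 1) (f : H2 E) : evalL E hζ f = evalDisc ζ f := rfl

theorem evalL_shift {ζ : ℂ} (hζ : ‖ζ‖ < 1) (f : H2 E) : evalL E hζ (shift E f) = ζ • evalL E hζ f := by
  have h : ∀ n : ℤ, fourierCoeff ((shift E f : H2 E) : L2 E) n = fourierCoeff (f : L2 E) (n - 1) :=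
    fourierCoeff_mulZ 1 (f : L2 E)
  rw [evalL_apply, evalL_apply, evalDisc, (summable_evalDisc hζ _).tsum_eq_zero_add, evalDisc,
    ← (summable_evalDisc hζ _).tsum_const_smul]
  simp only [h]
  rw [f.2 _ (by norm_num), smul_zero, zero_add]
  refine tsum_congr fun n => ?_
  rw [smul_smul, pow_succ', Nat.cast_succ, add_sub_cancel_right]

variable (E) in
/-- The constant functions as elements of `H²_E`. -/
def constH2 : E →L[ℂ] H2 E := (constL E).codRestrict (H2 E) constL_mem_H2

theorem fourierCoeff_constL (x : E) (n : ℤ) :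
    fourierCoeff (constL E x) n = if n = 0 then x else 0 := by
  rw [fourierCoeff_congr_ae (coeFn_constL x), fourierCoeff, integral_smul_const]
  have := congrFun (fourierCoeff_fourier (T := 1) 0) n
  simp only [fourierCoeff, fourier_zero, smul_eq_mul, mul_one] at this
  rw [this]
  by_cases hn : n = 0 <;> simp [hn]

theorem evalL_constH2 {ζ : ℂ} (hζ : ‖ζ‖ < 1) (x : E) : evalL E hζ (constH2 E x) = x := by
  have h : ∀ n : ℤ, fourierCoeff ((constH2 E x : H2 E) : L2 E) n = if n = 0 then x else 0 :=
    fourierCoeff_constL x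
  rw [evalL_apply, evalDisc, tsum_eq_single 0]
  · simp [h]
  · intro n hn
    simp [h, hn]

omit [CompleteSpace E] in
theorem clm_ext_of_shift {T S : H2 D →L[ℂ] E}
    (h : ∀ (n : ℕ) (x : D), T (((shift D) ^ n) (constH2 D x)) = S (((shift D) ^ n) (constH2 D x))) :
    T = S := by
  refine ContinuousLinearMap.ext_on dense_polynomials ?_
  rintro p ⟨n, x, hp⟩
  have : p = ((shift D) ^ n) (constH2 D x) := by
    refine Subtype.ext (hp.trans ?_)
    clear hp
    induction n with
    | zero => rfl
    | succ n ih =>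
      rw [pow_succ', mul_apply_eq_comp]
      change _ = mulZ 1 ((((shift D) ^ n) (constH2 D x) : H2 D) : L2 D)
      rw [← ih, ← mulZ_constL, ← mulZ_constL, mulZ_mulZ, Nat.cast_succ, add_comm]
  rw [this, h]

/-- Multiplication by an `H^∞` function, as an operator between Hardy spaces. -/
def IsHInfty.mulH2 {Φ : 𝕋 → D →L[ℂ] E} (hΦ : IsHInfty Φ) : H2 D →L[ℂ] H2 E :=
  (hΦ.essBounded.mulL.comp (H2 D).subtypeL).codRestrict (H2 E) fun f => hΦ.mulL_mem_H2 f.2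

theorem IsHInfty.coe_mulH2 {Φ : 𝕋 → D →L[ℂ] E} (hΦ : IsHInfty Φ) (f : H2 D) :
    (hΦ.mulH2 f : L2 E) = hΦ.essBounded.mulL f := rfl

theorem IsHInfty.mulH2_shift {Φ : 𝕋 → D →L[ℂ] E} (hΦ : IsHInfty Φ) (f : H2 D) :
    hΦ.mulH2 (shift D f) = shift E (hΦ.mulH2 f) :=
  Subtype.ext (hΦ.essBounded.mulL_mulZ 1 f)

/-- The value `Φ(ζ)` of an `H^∞` function at a point of the unit disc. -/
def IsHInfty.pointValue {Φ : 𝕋 → D →L[ℂ] E} (hΦ : IsHInfty Φ) {ζ : ℂ} (hζ : ‖ζ‖ < 1) : D →L[ℂ] E :=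
  (evalL E hζ).comp (hΦ.mulH2.comp (constH2 D))

/-- Both sides turn the shift into multiplication by ζ and agree on constants, hence on polynomials.
-/
theorem IsHInfty.evalL_mulH2 {Φ : 𝕋 → D →L[ℂ] E} (hΦ : IsHInfty Φ) {ζ : ℂ} (hζ : ‖ζ‖ < 1)
    (f : H2 D) : evalL E hζ (hΦ.mulH2 f) = hΦ.pointValue hζ (evalL D hζ f) := by
  have h : (evalL E hζ).comp hΦ.mulH2 = (hΦ.pointValue hζ).comp (evalL D hζ) := by
    refine clm_ext_of_shift fun n x => ?_
    induction n with
    | zero => simp [evalL_constH2, IsHInfty.pointValue]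
    | succ n ih =>
      simp only [ContinuousLinearMap.comp_apply] at ih ⊢
      rw [pow_succ', mul_apply_eq_comp, IsHInfty.mulH2_shift, evalL_shift, evalL_shift, ih, map_smul]
  exact congrArg (fun T => T f) h

theorem IsHInfty.comp {Φ : 𝕋 → D →L[ℂ] E} {Ψ : 𝕋 → F →L[ℂ] D} (hΦ : IsHInfty Φ)
    (hΨ : IsHInfty Ψ) : IsHInfty (fun t => Φ t ∘L Ψ t) := by
  refine (hΦ.essBounded.comp hΨ.essBounded).isHInfty_iff.2 fun x => ?_
  have : (hΦ.essBounded.comp hΨ.essBounded).mulL (constL F x)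
      = hΦ.essBounded.mulL (hΨ.essBounded.mulL (constL F x)) := by
    refine Lp.ext ?_
    filter_upwards [(hΦ.essBounded.comp hΨ.essBounded).coeFn_mulL_constL x,
      hΨ.essBounded.coeFn_mulL_constL x, hΦ.essBounded.coeFn_mulL
      (hΨ.essBounded.mulL (constL F x))] with t h1 h2 h3
    rw [h1, h3, h2]
    rfl
  rw [this]
  exact hΦ.mulL_mem_H2 (hΨ.mulL_mem_H2 (constL_mem_H2 x))

omit [CompleteSpace D] in
theorem isHInfty_const (T : D →L[ℂ] E) : IsHInfty (fun _ => T) := by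
  refine (essBounded_const T).isHInfty_iff.2 fun x => ?_
  have : (essBounded_const T).mulL (constL D x) = constL E (T x) := by
    refine Lp.ext ?_
    filter_upwards [(essBounded_const T).coeFn_mulL_constL x, coeFn_constL (T x)] with t h1 h2
    rw [h1, h2]
  rw [this]
  exact constL_mem_H2 _

theorem pointValue_const (T : D →L[ℂ] E) {ζ : ℂ} (hζ : ‖ζ‖ < 1) :
    (isHInfty_const T).pointValue hζ = T := by
  ext x
  have : (isHInfty_const T).mulH2 (constH2 D x) = constH2 E (T x) := by
    refine Subtype.ext (Lp.ext ?_)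
    filter_upwards [(essBounded_const T).coeFn_mulL_constL x, coeFn_constL (T x)] with t h1 h2
    exact h1.trans h2.symm
  change evalL E hζ ((isHInfty_const T).mulH2 (constH2 D x)) = _
  rw [this, evalL_constH2]

theorem eq_zero_of_evalDisc_eq_zero {f : H2 E} (h : ∀ ζ : ℂ, ‖ζ‖ < 1 → evalDisc ζ f = 0) :
    f = 0 := by
  let p : FormalMultilinearSeries ℂ ℂ E := fun n =>
    ContinuousMultilinearMap.mkPiRing ℂ (Fin n) (fourierCoeff (f : L2 E) (n : ℤ))
  have hcoeff : ∀ n, p.coeff n = fourierCoeff (f : L2 E) (n : ℤ) := fun n => by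
    simp [p, FormalMultilinearSeries.coeff]
  have hp : HasFPowerSeriesAt (0 : ℂ → E) p 0 := by
    rw [hasFPowerSeriesAt_iff]
    filter_upwards [Metric.ball_mem_nhds (0 : ℂ) one_pos] with ζ hζ
    have hζ' : ‖ζ‖ < 1 := by simpa using hζ
    simp only [hcoeff]
    have := (summable_evalDisc hζ' (f : L2 E)).hasSum
    rwa [show ∑' n : ℕ, ζ ^ n • fourierCoeff (f : L2 E) (n : ℤ) = 0 from h ζ hζ'] at this
  have hp0 := hp.eq_zero
  refine Subtype.ext (ext_fourierCoeff fun n => ?_)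
  have hz : fourierCoeff ((0 : H2 E) : L2 E) n = 0 := by
    rw [ZeroMemClass.coe_zero, fourierCoeff_congr_ae (Lp.coeFn_zero E 2 m)]
    simp [fourierCoeff]
  rw [hz]
  rcases lt_or_ge n 0 with hn | hn
  · exact f.2 n hn
  · obtain ⟨k, rfl⟩ := Int.eq_ofNat_of_zero_le hn
    rw [← hcoeff, hp0]
    simp [FormalMultilinearSeries.coeff]

/-- The algebra of scalar `H^∞` functions. -/
def scalarHInfty : Subring (𝕋 → ℂ) where
  carrier := {f | IsHInfty (fun t => ContinuousLinearMap.toSpanSingleton ℂ (f t))}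
  mul_mem' {f g} hf hg := by
    have h := IsHInfty.comp hf hg
    refine cast (congrArg IsHInfty (funext fun t => ?_)) h
    ext
    simp [mul_comm]
  one_mem' := by
    refine cast (congrArg IsHInfty (funext fun t => ?_)) (isHInfty_const (ContinuousLinearMap.id ℂ ℂ))
    ext
    simp
  zero_mem' := by
    refine cast (congrArg IsHInfty (funext fun t => ?_)) (isHInfty_const (0 : ℂ →L[ℂ] ℂ))
    ext
    simp
  add_mem' {f g} hf hg := by
    obtain ⟨C, hC⟩ := hf.2.1
    obtain ⟨C', hC'⟩ := hg.2.1
    refine ⟨fun x => ?_, ⟨C + C', ?_⟩, fun x n hn => ?_⟩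
    · refine ((hf.1 x).add (hg.1 x)).congr (Filter.Eventually.of_forall fun t => ?_)
      simp [mul_add]
    · filter_upwards [hC, hC'] with t h1 h2
      simp only [ContinuousLinearMap.norm_toSpanSingleton, Pi.add_apply] at h1 h2 ⊢
      exact (norm_add_le _ _).trans (add_le_add h1 h2)
    · have h := fourierCoeff.add ((hf.essBounded.isStrongL2 x).integrable (by norm_num))
        ((hg.essBounded.isStrongL2 x).integrable (by norm_num))
      have h2 := congrFun h n
      rw [Pi.add_apply, hf.2.2 x n hn, hg.2.2 x n hn, add_zero] at h2
      rw [← h2]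
      congr 1
      ext t
      simp [mul_add]
  neg_mem' {f} hf := by
    have h := IsHInfty.comp (isHInfty_const (-ContinuousLinearMap.id ℂ ℂ)) hf
    refine cast (congrArg IsHInfty (funext fun t => ?_)) h
    ext
    simp

theorem mem_scalarHInfty {f : 𝕋 → ℂ} :
    f ∈ scalarHInfty ↔ IsHInfty (fun t => ContinuousLinearMap.toSpanSingleton ℂ (f t)) := Iff.rfl

/-- The element of `H²` given by a scalar `H^∞` function. -/
def scalarToH2 (f : scalarHInfty) : H2 ℂ := (mem_scalarHInfty.1 f.2).mulH2 (constH2 ℂ 1)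

theorem coeFn_scalarToH2 (f : scalarHInfty) :
    ((scalarToH2 f : H2 ℂ) : L2 ℂ) =ᵐ[m] (f : 𝕋 → ℂ) := by
  filter_upwards [(mem_scalarHInfty.1 f.2).essBounded.coeFn_mulL_constL 1] with t ht
  refine ht.trans ?_
  simp

/-- Evaluation at a point of the disc as a ring homomorphism on scalar `H^∞` functions. -/
def evalRingHom {ζ : ℂ} (hζ : ‖ζ‖ < 1) : scalarHInfty →+* ℂ where
  toFun f := evalL ℂ hζ (scalarToH2 f)
  map_one' := by
    have : scalarToH2 1 = constH2 ℂ 1 := by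
      refine Subtype.ext (Lp.ext ?_)
      filter_upwards [coeFn_scalarToH2 1, coeFn_constL (1 : ℂ)] with t h1 h2
      exact h1.trans h2.symm
    rw [this, evalL_constH2]
  map_zero' := by
    have : scalarToH2 0 = 0 := by
      refine Subtype.ext (Lp.ext ?_)
      filter_upwards [coeFn_scalarToH2 0, Lp.coeFn_zero ℂ 2 m] with t h1 h2
      exact h1.trans h2.symm
    rw [this, map_zero]
  map_add' f g := by
    have : scalarToH2 (f + g) = scalarToH2 f + scalarToH2 g := by
      refine Subtype.ext (Lp.ext ?_)
      filter_upwards [coeFn_scalarToH2 (f + g), coeFn_scalarToH2 f, coeFn_scalarToH2 g,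
        Lp.coeFn_add ((scalarToH2 f : H2 ℂ) : L2 ℂ) ((scalarToH2 g : H2 ℂ) : L2 ℂ)]
        with t h1 h2 h3 h4
      refine h1.trans (Eq.trans ?_ h4.symm)
      rw [Pi.add_apply, h2, h3]
      rfl
    rw [this, map_add]
  map_mul' f g := by
    have hf := mem_scalarHInfty.1 f.2
    have : scalarToH2 (f * g) = hf.mulH2 (scalarToH2 g) := by
      refine Subtype.ext (Lp.ext ?_)
      filter_upwards [coeFn_scalarToH2 (f * g), coeFn_scalarToH2 g,
        hf.essBounded.coeFn_mulL (scalarToH2 g)] with t h1 h2 h3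
      refine h1.trans (Eq.trans ?_ h3.symm)
      rw [h2]
      simp [mul_comm]
    rw [this, IsHInfty.evalL_mulH2]
    have h1 := (hf.pointValue hζ).map_smul (evalL ℂ hζ (scalarToH2 g)) 1
    rw [smul_eq_mul, mul_one, smul_eq_mul, mul_comm] at h1
    exact h1

theorem ae_eq_zero_of_evalRingHom_eq_zero {f : scalarHInfty}
    (h : ∀ (ζ : ℂ) (hζ : ‖ζ‖ < 1), evalRingHom hζ f = 0) : (f : 𝕋 → ℂ) =ᵐ[m] 0 := by
  have h0 : scalarToH2 f = 0 := eq_zero_of_evalDisc_eq_zero fun ζ hζ => h ζ hζ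
  filter_upwards [coeFn_scalarToH2 f, Lp.coeFn_zero ℂ 2 m] with t h1 h2
  rw [h0] at h1
  exact h1.symm.trans h2

theorem IsHInfty.inner_mem_scalarHInfty {Φ : 𝕋 → D →L[ℂ] E} (hΦ : IsHInfty Φ) (e : E) (x : D) :
    (fun t => ⟪e, Φ t x⟫_ℂ) ∈ scalarHInfty := by
  refine mem_scalarHInfty.2 (cast (congrArg IsHInfty (funext fun t => ?_))
    ((isHInfty_const (innerSL ℂ e)).comp
      (hΦ.comp (isHInfty_const (ContinuousLinearMap.toSpanSingleton ℂ x)))))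
  ext
  simp

theorem IsHInfty.evalRingHom_inner {Φ : 𝕋 → D →L[ℂ] E} (hΦ : IsHInfty Φ) (e : E) (x : D) {ζ : ℂ}
    (hζ : ‖ζ‖ < 1) : evalRingHom hζ ⟨_, hΦ.inner_mem_scalarHInfty e x⟩
      = ⟪e, evalL E hζ (hΦ.mulH2 (constH2 D x))⟫_ℂ := by
  have he := isHInfty_const (innerSL ℂ e)
  have : scalarToH2 ⟨_, hΦ.inner_mem_scalarHInfty e x⟩ = he.mulH2 (hΦ.mulH2 (constH2 D x)) := by
    refine Subtype.ext (Lp.ext ?_)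
    filter_upwards [coeFn_scalarToH2 ⟨_, hΦ.inner_mem_scalarHInfty e x⟩,
      hΦ.essBounded.coeFn_mulL_constL x,
      he.essBounded.coeFn_mulL (hΦ.mulH2 (constH2 D x))] with t h1 h2 h3
    refine h1.trans (Eq.trans ?_ h3.symm)
    change _ = ⟪e, hΦ.essBounded.mulL (constL D x) t⟫_ℂ
    rw [h2]
  change evalL ℂ hζ _ = _
  rw [this, IsHInfty.evalL_mulH2, pointValue_const]
  rfl

/-- An inner function maps finite orthonormal systems to linearly independent ones at some point of
the disc. -/
theorem IsInner.exists_linearIndependent [TopologicalSpace.SeparableSpace E]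
    {Δ : 𝕋 → D →L[ℂ] E} (hΔ : IsInner Δ) {k : ℕ} {x : Fin k → D} (hx : Orthonormal ℂ x) :
    ∃ (ζ : ℂ) (hζ : ‖ζ‖ < 1),
      LinearIndependent ℂ (fun i => evalL E hζ (hΔ.1.mulH2 (constH2 D (x i)))) := by
  by_contra! hdep
  -- Dependence of the columns is detected by determinants of scalar analytic functions. Testing
  -- against a dense sequence leaves countably many of them, hence one common null set on the
  -- circle.
  let M : (Fin k → ℕ) → Matrix (Fin k) (Fin k) scalarHInfty := fun σ =>
    Matrix.of fun j i => ⟨_, hΔ.1.inner_mem_scalarHInfty (TopologicalSpace.denseSeq E (σ j)) (x i)⟩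
  -- A dependence at ζ is a null vector of the matrix at ζ; a determinant vanishing throughout the
  -- disc vanishes a.e. on the circle.
  have hM : ∀ σ, ((M σ).det : 𝕋 → ℂ) =ᵐ[m] 0 := by
    intro σ
    refine ae_eq_zero_of_evalRingHom_eq_zero fun ζ hζ => ?_
    rw [RingHom.map_det, ← Matrix.exists_mulVec_eq_zero_iff]
    obtain ⟨c, hc, i, hi⟩ := Fintype.not_linearIndependent_iff.1 (hdep ζ hζ)
    refine ⟨c, fun h => hi (congrFun h i), ?_⟩
    ext j
    have h1 := congrArg (fun v => ⟪TopologicalSpace.denseSeq E (σ j), v⟫_ℂ) hc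
    simp only [inner_sum, inner_smul_right, inner_zero_right] at h1
    rw [Pi.zero_apply, ← h1, Matrix.mulVec, dotProduct]
    refine Finset.sum_congr rfl fun i _ => ?_
    rw [mul_comm, ← IsHInfty.evalRingHom_inner]
    rfl
  have hdet : ∀ᵐ t ∂m, ∀ σ : Fin k → ℕ,
      (Matrix.of fun j i => ⟪TopologicalSpace.denseSeq E (σ j), Δ t (x i)⟫_ℂ).det = 0 := by
    refine ae_all_iff.2 fun σ => ?_
    filter_upwards [hM σ] with t ht
    have h1 := RingHom.map_det ((Pi.evalRingHom (fun _ : 𝕋 => ℂ) t).comp scalarHInfty.subtype) (M σ)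
    exact h1.symm.trans ht
  obtain ⟨t, ht, hnorm⟩ := (hdet.and hΔ.norm_apply).exists
  let T : D →ₗᵢ[ℂ] E := ⟨(Δ t : D →ₗ[ℂ] E), hnorm⟩
  have hT : Orthonormal ℂ (fun i => Δ t (x i)) := hx.comp_linearIsometry T
  have hcont : Continuous fun e : Fin k → E =>
      (Matrix.of fun j i => ⟪e j, Δ t (x i)⟫_ℂ : Matrix (Fin k) (Fin k) ℂ).det := by
    refine Continuous.matrix_det ?_
    refine continuous_matrix fun j i => ?_
    simp only [Matrix.of_apply]
    fun_prop
  have hzero : ∀ e : Fin k → E, (Matrix.of fun j i => ⟪e j, Δ t (x i)⟫_ℂ).det = 0 := by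
    have hd : DenseRange (Pi.map fun _ : Fin k => TopologicalSpace.denseSeq E) :=
      DenseRange.piMap fun _ => TopologicalSpace.denseRange_denseSeq E
    intro e
    exact congrFun (hd.equalizer hcont continuous_const (funext fun σ => ht σ)) e
  -- With the vectors Δ(t)xᵢ themselves as test vectors, the matrix is the Gram matrix of an
  -- orthonormal system, of determinant 1.
  have h1 := hzero fun i => Δ t (x i)
  have h2 : (Matrix.of fun j i => ⟪Δ t (x j), Δ t (x i)⟫_ℂ : Matrix (Fin k) (Fin k) ℂ) = 1 := by
    ext j i
    rw [Matrix.of_apply, Matrix.one_apply, orthonormal_iff_ite.1 hT j i]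
  rw [h2, Matrix.det_one] at h1
  exact one_ne_zero h1

end Evaluation

/-! ### Constant inner functions and factorization through Δ -/

section Factorization

variable {D E E' F : Type*} [NormedAddCommGroup D] [InnerProductSpace ℂ D] [CompleteSpace D]
  [NormedAddCommGroup E] [InnerProductSpace ℂ E] [CompleteSpace E]
  [NormedAddCommGroup E'] [InnerProductSpace ℂ E'] [CompleteSpace E']
  [NormedAddCommGroup F] [InnerProductSpace ℂ F] [CompleteSpace F]

omit [CompleteSpace D] [CompleteSpace E] in
theorem ae_clm_ext [TopologicalSpace.SeparableSpace D] {Φ Ψ : 𝕋 → D →L[ℂ] E}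
    (h : ∀ x, ∀ᵐ t ∂m, Φ t x = Ψ t x) : Φ =ᵐ[m] Ψ := by
  have : ∀ᵐ t ∂m, ∀ n, Φ t (TopologicalSpace.denseSeq D n) = Ψ t (TopologicalSpace.denseSeq D n) :=
    ae_all_iff.2 fun n => h _
  filter_upwards [this] with t ht
  refine ContinuousLinearMap.ext fun x => ?_
  exact congrFun ((TopologicalSpace.denseRange_denseSeq D).equalizer (Φ t).continuous
    (Ψ t).continuous (funext ht)) x

omit [CompleteSpace D] [CompleteSpace E] in
theorem IsStrongH2.congr {Φ Ψ : 𝕋 → D →L[ℂ] E} (hΦ : IsStrongH2 Φ) (h : Φ =ᵐ[m] Ψ) :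
    IsStrongH2 Ψ := by
  have hx : ∀ x, (fun t => Φ t x) =ᵐ[m] fun t => Ψ t x := fun x => by
    filter_upwards [h] with t ht
    rw [ht]
  refine ⟨fun x => (hΦ.1 x).ae_eq (hx x), fun x n hn => ?_⟩
  rw [← fourierCoeff_congr_ae (hx x), hΦ.2 x n hn]

omit [CompleteSpace D] in
theorem IsStrongH2.const_comp {Φ : 𝕋 → D →L[ℂ] E} (hΦ : IsStrongH2 Φ) (T : E →L[ℂ] F) :
    IsStrongH2 (fun t => T ∘L Φ t) := by
  refine ⟨fun x => T.comp_memLp' (hΦ.1 x), fun x n hn => ?_⟩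
  have h1 := T.integral_comp_comm (((hΦ.1 x).integrable (by norm_num)).fourier_smul (-n))
  have h2 := hΦ.2 x n hn
  rw [fourierCoeff] at h2 ⊢
  rw [h2, map_zero] at h1
  rw [← h1]
  simp

theorem adjoint_surjective_of_norm {T : D →L[ℂ] E} (h : ∀ x, ‖T x‖ = ‖x‖) :
    Function.Surjective (ContinuousLinearMap.adjoint T) := fun x =>
  ⟨T x, congrArg (fun S => S x) (adjoint_comp_of_norm h)⟩

theorem norm_adjoint_of_surjective {T : D →L[ℂ] E} (h : ∀ x, ‖T x‖ = ‖x‖)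
    (hs : Function.Surjective T) (y : E) : ‖ContinuousLinearMap.adjoint T y‖ = ‖y‖ := by
  obtain ⟨x, rfl⟩ := hs y
  have := congrArg (fun S => S x) (adjoint_comp_of_norm h)
  rw [h]
  exact congrArg norm this

theorem adjoint_linearIsometryEquiv (U : D ≃ₗᵢ[ℂ] E) :
    ContinuousLinearMap.adjoint U.toContinuousLinearEquiv.toContinuousLinearMap
      = U.symm.toContinuousLinearEquiv.toContinuousLinearMap := by
  refine ContinuousLinearMap.ext fun y => ext_inner_left ℂ fun x => ?_
  rw [ContinuousLinearMap.adjoint_inner_right]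
  change ⟪U x, y⟫_ℂ = ⟪x, U.symm y⟫_ℂ
  rw [← U.inner_map_map, U.apply_symm_apply]

omit [CompleteSpace E] in
theorem fourierCoeff_comp_neg (f : 𝕋 → E) (n : ℤ) :
    fourierCoeff (fun t => f (-t)) n = fourierCoeff f (-n) := by
  rw [fourierCoeff, fourierCoeff, ← integral_neg_eq_self]
  refine integral_congr_ae (Filter.Eventually.of_forall fun t => ?_)
  simp only [neg_neg]
  congr 1
  simp only [fourier_apply]
  congr 2
  simp

omit [CompleteSpace D] in
/-- An inner function `Ω` with surjective values such that `Ω̆` is analytic is constant. -/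
theorem IsInner.ae_eq_const_of_flip [TopologicalSpace.SeparableSpace D] {Ω : 𝕋 → D →L[ℂ] E}
    (hΩ : IsInner Ω) (hs : ∀ᵐ t ∂m, Function.Surjective (Ω t))
    (h : ∀ (x : D) (n : ℤ), n < 0 → fourierCoeff (fun t => Ω (-t) x) n = 0) :
    ∃ U : D ≃ₗᵢ[ℂ] E, ∀ᵐ t ∂m, Ω t = U.toContinuousLinearEquiv.toContinuousLinearMap := by
  have hconst : ∀ x, ∀ᵐ t ∂m, Ω t x = fourierCoeff (fun t => Ω t x) 0 := by
    intro x
    set c := fourierCoeff (fun t => Ω t x) 0 with hc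
    -- Analyticity of Ω removes the negative coefficients, that of its flip the positive ones.
    have heq : hΩ.essBounded.mulL (constL D x) = constL E c := by
      refine ext_fourierCoeff fun n => ?_
      rw [fourierCoeff_constL, fourierCoeff_congr_ae (hΩ.essBounded.coeFn_mulL_constL x)]
      split_ifs with hn
      · rw [hn]
      · rcases lt_or_gt_of_ne hn with hn | hn
        · exact hΩ.1.2.2 x n hn
        · have := h x (-n) (by omega)
          rwa [fourierCoeff_comp_neg (fun t => Ω t x), neg_neg] at this
    filter_upwards [hΩ.essBounded.coeFn_mulL_constL x, coeFn_constL c] with t h1 h2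
    rw [← h1, heq, h2]
  have hall : ∀ᵐ t ∂m, ∀ n, Ω t (TopologicalSpace.denseSeq D n)
      = fourierCoeff (fun t => Ω t (TopologicalSpace.denseSeq D n)) 0 :=
    ae_all_iff.2 fun n => hconst _
  obtain ⟨t₀, ⟨h1, h2⟩, h3⟩ := ((hall.and hs).and hΩ.norm_apply).exists
  let U : D ≃ₗᵢ[ℂ] E := LinearIsometryEquiv.ofSurjective ⟨(Ω t₀ : D →ₗ[ℂ] E), h3⟩ h2
  refine ⟨U, ?_⟩
  filter_upwards [hall] with t ht
  refine ContinuousLinearMap.ext fun x => ?_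
  exact congrFun ((TopologicalSpace.denseRange_denseSeq D).equalizer (Ω t).continuous
    (Ω t₀).continuous (funext fun n => (ht n).trans (h1 n).symm)) x

variable {Φ : 𝕋 → D →L[ℂ] E}

/-- The tilde of Φ^*Δ is the flip of Δ^*Φ, a bounded function times a strong L² one. -/
theorem isStrongL2_tilde_adjoint_comp [TopologicalSpace.SeparableSpace E'] (hΦ : IsStrongL2 Φ)
    {Δ : 𝕋 → E' →L[ℂ] E} (hΔ : EssBounded Δ) :
    IsStrongL2 (tilde fun t => ContinuousLinearMap.adjoint (Φ t) ∘L Δ t) := by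
  intro x
  have h := (hΔ.adjoint.memLp (hΦ x)).comp_measurePreserving (Measure.measurePreserving_neg m)
  refine h.ae_eq (Filter.Eventually.of_forall fun t => ?_)
  simp [tilde, ContinuousLinearMap.adjoint_comp]

theorem fourierCoeff_inner_tilde (hΦ : IsStrongL2 Φ) {Δ : 𝕋 → E' →L[ℂ] E} (hΔ : EssBounded Δ)
    (x : D) (y : E') (n : ℤ) :
    fourierCoeff (fun t => ⟪y, tilde (fun t => ContinuousLinearMap.adjoint (Φ t) ∘L Δ t) t x⟫_ℂ) n
      = ⟪mulZ (-n) (hΔ.mulL (constL E' y)), (hΦ x).toLp _⟫_ℂ := by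
  have h : (fun t => ⟪y, tilde (fun t => ContinuousLinearMap.adjoint (Φ t) ∘L Δ t) t x⟫_ℂ)
      = fun t => (fun s => ⟪Δ s y, Φ s x⟫_ℂ) (-t) := by
    ext t
    simp [tilde, ContinuousLinearMap.adjoint_comp, ContinuousLinearMap.adjoint_inner_right]
  rw [h, fourierCoeff_comp_neg (fun s => ⟪Δ s y, Φ s x⟫_ℂ), ← fourierCoeff_inner]
  refine congrFun (fourierCoeff_congr_ae ?_) _
  filter_upwards [hΔ.coeFn_mulL_constL y, MemLp.coeFn_toLp (hΦ x)] with t h1 h2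
  rw [h1, h2]

/-- Paired with y, the negative coefficients of the tilde of Φ^*Δ are the numbers ⟪zⁿ⁺¹Δy, Φx⟫ that
define the analytic kernel. -/
theorem IsInner.isStrongH2_tilde_iff [TopologicalSpace.SeparableSpace E'] (hΦ : IsStrongL2 Φ)
    {Δ : 𝕋 → E' →L[ℂ] E} (hΔ : IsInner Δ) :
    IsStrongH2 (tilde fun t => ContinuousLinearMap.adjoint (Φ t) ∘L Δ t) ↔
      ∀ y, hΔ.essBounded.mulL (constL E' y) ∈ analyticKernel hΦ := by
  have hL2 := isStrongL2_tilde_adjoint_comp hΦ hΔ.essBounded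
  have hcoef : ∀ x y n, ⟪y, fourierCoeff
      (fun t => tilde (fun t => ContinuousLinearMap.adjoint (Φ t) ∘L Δ t) t x) n⟫_ℂ
      = ⟪mulZ (-n) (hΔ.essBounded.mulL (constL E' y)), (hΦ x).toLp _⟫_ℂ := fun x y n => by
    rw [inner_fourierCoeff ((hL2 x).integrable (by norm_num)),
      fourierCoeff_inner_tilde hΦ hΔ.essBounded]
  constructor
  · intro h y
    refine mem_analyticKernel.2 ⟨hΔ.essBounded.isHInfty_iff.1 hΔ.1 y, fun n x => ?_⟩
    have := hcoef x y (-(n + 1 : ℕ))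
    rwa [h.2 x _ (by omega), inner_zero_right, neg_neg, eq_comm] at this
  · intro h
    refine ⟨hL2, fun x n hn => ext_inner_left ℂ fun y => ?_⟩
    obtain ⟨k, hk⟩ := Int.eq_ofNat_of_zero_le (show 0 ≤ -n - 1 by omega)
    rw [hcoef, inner_zero_right, show -n = ((k + 1 : ℕ) : ℤ) by omega]
    exact (mem_analyticKernel.1 (h y)).2 k x

omit [CompleteSpace F] in
/-- If the columns of an inner function `Ψ` lie in `ΔH²`, then `Ψ = ΔΘ` with `Θ` inner. -/
theorem IsInner.exists_inner_factor [TopologicalSpace.SeparableSpace E']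
    [TopologicalSpace.SeparableSpace F] {Δ : 𝕋 → E' →L[ℂ] E} (hΔ : IsInner Δ) {Ψ : 𝕋 → F →L[ℂ] E}
    (hΨ : IsInner Ψ)
    (h : ∀ y, ∃ g ∈ H2 E', hΔ.essBounded.mulL g = hΨ.essBounded.mulL (constL F y)) :
    ∃ Θ : 𝕋 → F →L[ℂ] E', IsInner Θ ∧ ∀ᵐ t ∂m, Ψ t = Δ t ∘L Θ t := by
  -- Since Δ^*Δ = 1, the only candidate is Θ = Δ^*Ψ.
  have hb := hΔ.essBounded.adjoint.comp hΨ.essBounded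
  have key : ∀ y, hb.mulL (constL F y) ∈ H2 E' ∧
      ∀ᵐ t ∂m, Ψ t y = (Δ t ∘L (ContinuousLinearMap.adjoint (Δ t) ∘L Ψ t)) y := by
    intro y
    obtain ⟨g, hg, hgy⟩ := h y
    have hpt : ∀ᵐ t ∂m, Ψ t y = Δ t (g t) := by
      filter_upwards [hΔ.essBounded.coeFn_mulL g, hΨ.essBounded.coeFn_mulL_constL y] with t h1 h2
      rw [← h2, ← hgy, h1]
    have had : ∀ᵐ t ∂m, ContinuousLinearMap.adjoint (Δ t) (Ψ t y) = g t := by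
      filter_upwards [hpt, hΔ.adjoint_comp] with t h1 h2
      rw [h1]
      exact congrArg (fun S => S (g t)) h2
    constructor
    · have : hb.mulL (constL F y) = g := by
        refine Lp.ext ?_
        filter_upwards [hb.coeFn_mulL_constL y, had] with t h1 h2
        rw [h1]
        exact h2
      rwa [this]
    · filter_upwards [hpt, had] with t h1 h2
      change Ψ t y = Δ t (ContinuousLinearMap.adjoint (Δ t) (Ψ t y))
      rw [h2, h1]
  have heq : ∀ᵐ t ∂m, Ψ t = Δ t ∘L (ContinuousLinearMap.adjoint (Δ t) ∘L Ψ t) :=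
    ae_clm_ext fun y => (key y).2
  refine ⟨_, hb.isInner_of_norm (fun y => (key y).1) ?_, heq⟩
  filter_upwards [heq, hΔ.norm_apply, hΨ.norm_apply] with t h1 h2 h3 x
  rw [← h3 x, ← h2]
  exact congrArg (fun S => ‖S x‖) h1.symm

end Factorization

/-! ### Degree of non-cyclicity versus the dimension of the initial space -/

section Noncyclicity

variable {D : Type*} [NormedAddCommGroup D] [InnerProductSpace ℂ D] [CompleteSpace D]

/-- Each g in the complement is Δf, so g(ζ) = Δ(ζ)f(ζ) lies in the range of Δ(ζ), whose rank is at
most dim E'. -/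
theorem IsInner.nc_le_dim {E E' : Type u} [NormedAddCommGroup E] [InnerProductSpace ℂ E]
    [CompleteSpace E] [NormedAddCommGroup E'] [InnerProductSpace ℂ E'] [CompleteSpace E']
    {ι : Type*} (b : HilbertBasis ι ℂ D) {Φ : 𝕋 → D →L[ℂ] E} (hΦ : IsStrongL2 Φ)
    {Δ : 𝕋 → E' →L[ℂ] E} (hΔ : IsInner Δ)
    (h : ∀ f ∈ analyticKernel hΦ, ∃ g ∈ H2 E', hΔ.essBounded.mulL g = f) :
    nc (analyticColumns b hΦ) ≤ dim E' := by
  refine iSup₂_le fun ζ hζ => ?_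
  have hζ' : ‖ζ‖ < 1 := by simpa using hζ
  have hle : Submodule.span ℂ {e : E | ∃ g ∈ (backwardSpan (analyticColumns b hΦ))ᗮ,
      e = evalDisc ζ g} ≤ LinearMap.range (hΔ.1.pointValue hζ' : E' →ₗ[ℂ] E) := by
    refine Submodule.span_le.2 ?_
    rintro _ ⟨g, hg, rfl⟩
    obtain ⟨f, hf, hfg⟩ := h _ (mem_analyticKernel_of_mem_orthogonal b hΦ hg)
    have hgf : g = hΔ.1.mulH2 ⟨f, hf⟩ := Subtype.ext hfg.symm
    refine ⟨evalL E' hζ' ⟨f, hf⟩, ?_⟩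
    rw [← evalL_apply hζ', hgf, IsHInfty.evalL_mulH2]
    rfl
  exact OrderHomClass.mono Cardinal.toENat
    ((Submodule.rank_mono hle).trans (rank_range_le _))

theorem natCast_le_dim_iff {V : Type*} [AddCommGroup V] [Module ℂ V] {k : ℕ} :
    (k : ℕ∞) ≤ dim V ↔ ∃ x : Fin k → V, LinearIndependent ℂ x := by
  rw [dim, Cardinal.natCast_le_toENat, Module.le_rank_iff]

theorem dim_eq_finrank {V : Type*} [AddCommGroup V] [Module ℂ V] [FiniteDimensional ℂ V] :
    dim V = Module.finrank ℂ V := by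
  rw [dim, ← Module.finrank_eq_rank, Cardinal.toENat_nat]

theorem finrank_le_of_dim_le {V : Type*} [AddCommGroup V] [Module ℂ V] {k : ℕ}
    (h : dim V ≤ k) : FiniteDimensional ℂ V ∧ Module.finrank ℂ V ≤ k := by
  rw [dim, Cardinal.toENat_le_natCast] at h
  have hfin : FiniteDimensional ℂ V :=
    Module.rank_lt_aleph0_iff.1 (h.trans_lt Cardinal.natCast_lt_aleph0)
  refine ⟨hfin, ?_⟩
  rwa [← Module.finrank_eq_rank, Nat.cast_le] at h

theorem IsInner.mulZ_one {E E' : Type*} [NormedAddCommGroup E] [InnerProductSpace ℂ E]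
    [CompleteSpace E] [NormedAddCommGroup E'] [InnerProductSpace ℂ E'] [CompleteSpace E']
    {Δ : 𝕋 → E' →L[ℂ] E} (hΔ : IsInner Δ) :
    ∃ h : IsInner (fun t => fourier 1 t • Δ t),
      ∀ y, h.1.mulH2 (constH2 E' y) = shift E (hΔ.1.mulH2 (constH2 E' y)) := by
  have hb : EssBounded (fun t => fourier 1 t • Δ t) := by
    obtain ⟨C, hC⟩ := hΔ.essBounded.bound
    refine ⟨fun x => ?_, C, ?_⟩
    · exact (fourier 1).continuous.aestronglyMeasurable.smul (hΔ.1.1 x)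
    · filter_upwards [hC] with t ht
      rwa [norm_smul, norm_fourier_apply, one_mul]
  have hmul : ∀ y, hb.mulL (constL E' y) = mulZ 1 (hΔ.essBounded.mulL (constL E' y)) := fun y => by
    refine Lp.ext ?_
    filter_upwards [hb.coeFn_mulL_constL y, hΔ.essBounded.coeFn_mulL_constL y,
      coeFn_mulZ 1 (hΔ.essBounded.mulL (constL E' y))] with t h1 h2 h3
    rw [h1, h3, h2]
    rfl
  refine ⟨hb.isInner_of_norm (fun y => ?_) ?_, fun y => Subtype.ext (hmul y)⟩
  · rw [hmul]
    exact mulZ_mem_H2 (hΔ.essBounded.isHInfty_iff.1 hΔ.1 y) 1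
  · filter_upwards [hΔ.norm_apply] with t ht x
    change ‖fourier 1 t • Δ t x‖ = ‖x‖
    rw [norm_smul, norm_fourier_apply, one_mul, ht]

/-- Columns of Δ lie only in the kernel, those of zΔ in the complement of the backward span; zΔ is
inner too, so k of its columns are independent at some ζ. That point may depend on k, and comparing
with every natural k covers infinite dimension. -/
theorem IsInner.dim_le_nc {E E' : Type*} [NormedAddCommGroup E] [InnerProductSpace ℂ E]
    [CompleteSpace E] [TopologicalSpace.SeparableSpace E]
    [NormedAddCommGroup E'] [InnerProductSpace ℂ E'] [CompleteSpace E']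
    {ι : Type*} (b : HilbertBasis ι ℂ D) {Φ : 𝕋 → D →L[ℂ] E} (hΦ : IsStrongL2 Φ)
    {Δ : 𝕋 → E' →L[ℂ] E} (hΔ : IsInner Δ)
    (h : ∀ y, hΔ.essBounded.mulL (constL E' y) ∈ analyticKernel hΦ) :
    dim E' ≤ nc (analyticColumns b hΦ) := by
  refine ENat.forall_natCast_le_iff_le.1 fun k hk => ?_
  obtain ⟨x, hx⟩ := natCast_le_dim_iff.1 hk
  obtain ⟨hΔ', hshift⟩ := hΔ.mulZ_one
  obtain ⟨ζ, hζ, hlin⟩ :=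
    hΔ'.exists_linearIndependent (InnerProductSpace.gramSchmidtNormed_orthonormal hx)
  refine le_trans ?_ (le_iSup₂ (f := fun ζ (_ : ζ ∈ Metric.ball (0 : ℂ) 1) =>
    dim (Submodule.span ℂ {e : E | ∃ g ∈ (backwardSpan (analyticColumns b hΦ))ᗮ,
      e = evalDisc ζ g})) ζ (by simpa using hζ))
  refine natCast_le_dim_iff.2 ⟨fun i => ⟨_, Submodule.subset_span
    ⟨shift E (hΔ.1.mulH2 (constH2 E' (InnerProductSpace.gramSchmidtNormed ℂ x i))),
      shift_mem_orthogonal_of_mem_analyticKernel b hΦ (h _), rfl⟩⟩, ?_⟩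
  refine LinearIndependent.of_comp (Submodule.subtype _) ?_
  simp only [hshift] at hlin
  exact hlin

end Noncyclicity

/-! ### Existence of the canonical decomposition -/

section Existence

variable {D : Type v} {E E' : Type u} [NormedAddCommGroup D] [InnerProductSpace ℂ D]
  [CompleteSpace D] [NormedAddCommGroup E] [InnerProductSpace ℂ E] [CompleteSpace E]
  [NormedAddCommGroup E'] [InnerProductSpace ℂ E'] [CompleteSpace E']
  [TopologicalSpace.SeparableSpace E] [TopologicalSpace.SeparableSpace E'] {Φ : 𝕋 → D →L[ℂ] E}

/-- If `ΔH²` is the analytic kernel of `Φ`, then `Δ` and `Φ^*Δ` are right coprime. -/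
theorem IsInner.rightCoprime (hΦ : IsStrongL2 Φ) {Δ : 𝕋 → E' →L[ℂ] E} (hΔ : IsInner Δ)
    (hker : ∀ f ∈ analyticKernel hΦ, ∃ g ∈ H2 E', hΔ.essBounded.mulL g = f) :
    RightCoprime Δ (fun t => ContinuousLinearMap.adjoint (Φ t) ∘L Δ t) := by
  rintro D' _ _ _ _ Ω ⟨hΩ, G, hG, hGΔ⟩ ⟨-, H, hH, hHA⟩
  -- Δ̃(t) is the adjoint of an isometry, hence onto, and it factors through Ω(t).
  have hsurj : ∀ᵐ t ∂m, Function.Surjective (Ω t) := by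
    filter_upwards [hGΔ, ae_neg hΔ.norm_apply] with t h1 h2 y
    obtain ⟨x, hx⟩ := adjoint_surjective_of_norm h2 y
    refine ⟨G t x, ?_⟩
    have := congrArg (fun S => S x) h1
    exact this.symm.trans hx
  have hGeq : ∀ᵐ t ∂m, ContinuousLinearMap.adjoint (Ω t) ∘L tilde Δ t = G t := by
    filter_upwards [hGΔ, hΩ.adjoint_comp] with t h1 h2
    rw [h1, ← ContinuousLinearMap.comp_assoc, h2, ContinuousLinearMap.id_comp]
  have hHeq : ∀ᵐ t ∂m, ContinuousLinearMap.adjoint (Ω t) ∘L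
      tilde (fun t => ContinuousLinearMap.adjoint (Φ t) ∘L Δ t) t = H t := by
    filter_upwards [hHA, hΩ.adjoint_comp] with t h1 h2
    rw [h1, ← ContinuousLinearMap.comp_assoc, h2, ContinuousLinearMap.id_comp]
  -- G is a priori only strong H²; the formula G = Ω^*Δ̃ bounds it, and taking tildes turns it into
  -- ΔΩ̆ = G̃, which is therefore analytic.
  have hGb : EssBounded G := (hΩ.essBounded.adjoint.comp hΔ.essBounded.tilde).congr hGeq
  have hflip : EssBounded (fun t => Δ t ∘L Ω (-t)) := hΔ.essBounded.comp hΩ.essBounded.flip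
  have hadj : ∀ t, ContinuousLinearMap.adjoint (ContinuousLinearMap.adjoint (Ω (-t)) ∘L
      tilde Δ (-t)) = Δ t ∘L Ω (-t) := fun t => by
    simp [tilde, ContinuousLinearMap.adjoint_comp]
  have htilde : tilde G =ᵐ[m] fun t => Δ t ∘L Ω (-t) := by
    filter_upwards [ae_neg hGeq] with t ht
    rw [← hadj, ht]
    rfl
  have hGt : IsHInfty (tilde G) :=
    hGb.tilde.isHInfty_of_isStrongH2 ⟨hGb.tilde.isStrongL2, fun y _ hn =>
      fourierCoeff_tilde_eq_zero hG hGb.tilde.isStrongL2 y hn⟩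
  have hinner : IsInner (fun t => Δ t ∘L Ω (-t)) := by
    refine hflip.isInner_of_norm
      (hflip.isHInfty_iff.1 (hflip.isHInfty_of_isStrongH2 (hGt.isStrongH2.congr htilde))) ?_
    filter_upwards [hΔ.norm_apply, ae_neg hΩ.norm_apply] with t h1 h2 x
    exact (h1 _).trans (h2 x)
  -- The tilde of Φ^*ΔΩ̆ is Ω^*Ã = H, which is analytic.
  have hmem := (hinner.isStrongH2_tilde_iff hΦ).1 (hH.congr (by
    filter_upwards [hHeq] with t ht
    rw [← ht]
    simp [tilde, ContinuousLinearMap.adjoint_comp, ContinuousLinearMap.comp_assoc]))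
  refine hΩ.ae_eq_const_of_flip hsurj fun y n hn => ?_
  -- Now ΔΩ̆y = Δg with g ∈ H², and injectivity of Δ(t) gives Ω̆y = g.
  obtain ⟨g, hg, hgy⟩ := hker _ (hmem y)
  have hgΩ : ∀ᵐ t ∂m, g t = Ω (-t) y := by
    filter_upwards [hΔ.essBounded.coeFn_mulL g, hinner.essBounded.coeFn_mulL_constL y,
      hΔ.2] with t h1 h2 h3
    refine h3.injective ?_
    rw [← h1, hgy, h2]
    rfl
  rw [← fourierCoeff_congr_ae hgΩ, hg n hn]

theorem isCanonicalDecomposition_of_analyticKernel (hΦ : IsStrongL2 Φ)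
    {Δ : 𝕋 → E' →L[ℂ] E} (hΔ : IsInner Δ)
    (hker : ∀ f, f ∈ analyticKernel hΦ ↔ ∃ g ∈ H2 E', hΔ.essBounded.mulL g = f)
    {ι : Type w} (b : HilbertBasis ι ℂ D) :
    IsCanonicalDecomposition b hΦ Δ (fun t => ContinuousLinearMap.adjoint (Φ t) ∘L Δ t)
      (fun t => Φ t - Δ t ∘L (ContinuousLinearMap.adjoint (Δ t) ∘L Φ t)) where
  eq_add := Filter.Eventually.of_forall fun t => by
    simp [ContinuousLinearMap.adjoint_comp]
  inner := hΔ
  strongH2 := (hΔ.isStrongH2_tilde_iff hΦ).2 fun y => (hker _).2 ⟨_, constL_mem_H2 y, rfl⟩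
  strongL2 := fun x => (hΦ x).sub (hΔ.essBounded.memLp (hΔ.essBounded.adjoint.memLp (hΦ x)))
  coprime := hΔ.rightCoprime hΦ fun f hf => (hker f).1 hf
  adjoint_mul := by
    filter_upwards [hΔ.adjoint_comp] with t ht
    rw [ContinuousLinearMap.comp_sub, ← ContinuousLinearMap.comp_assoc, ht,
      ContinuousLinearMap.id_comp, sub_self]
  nc_le := hΔ.nc_le_dim b hΦ fun f hf => (hker f).1 hf

end Existence

/-! ### Uniqueness for finite-dimensional initial space -/

section Uniqueness

variable {D E : Type*} [NormedAddCommGroup D] [InnerProductSpace ℂ D] [CompleteSpace D]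
  [NormedAddCommGroup E] [InnerProductSpace ℂ E] [CompleteSpace E]
  {E₁ : Type*} [NormedAddCommGroup E₁] [InnerProductSpace ℂ E₁] [CompleteSpace E₁]
  {Φ : 𝕋 → D →L[ℂ] E} {hΦ : IsStrongL2 Φ} {ι : Type*} {b : HilbertBasis ι ℂ D}
  {Δ₁ : 𝕋 → E₁ →L[ℂ] E} {A₁ : 𝕋 → E₁ →L[ℂ] D} {B₁ : 𝕋 → D →L[ℂ] E}

/-- Multiply Φ = Δ₁A₁^* + B₁ by Δ₁^* and use Δ₁^*Δ₁ = 1, Δ₁^*B₁ = 0; thus Δ₁ determines A₁. -/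
theorem IsCanonicalDecomposition.eq_adjoint_comp
    (h : IsCanonicalDecomposition b hΦ Δ₁ A₁ B₁) :
    ∀ᵐ t ∂m, A₁ t = ContinuousLinearMap.adjoint (Φ t) ∘L Δ₁ t := by
  filter_upwards [h.eq_add, h.inner.adjoint_comp, h.adjoint_mul] with t h1 h2 h3
  have h4 : ContinuousLinearMap.adjoint (B₁ t) ∘L Δ₁ t = 0 := by
    have := congrArg ContinuousLinearMap.adjoint h3
    rwa [ContinuousLinearMap.adjoint_comp, ContinuousLinearMap.adjoint_adjoint, map_zero] at this
  rw [h1, map_add, ContinuousLinearMap.adjoint_comp, ContinuousLinearMap.adjoint_adjoint,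
    ContinuousLinearMap.add_comp, ContinuousLinearMap.comp_assoc, h2, h4, add_zero,
    ContinuousLinearMap.comp_id]

theorem IsCanonicalDecomposition.isStrongH2_tilde (h : IsCanonicalDecomposition b hΦ Δ₁ A₁ B₁) :
    IsStrongH2 (tilde fun t => ContinuousLinearMap.adjoint (Φ t) ∘L Δ₁ t) := by
  refine h.strongH2.congr ?_
  filter_upwards [ae_neg h.eq_adjoint_comp] with t ht
  rw [tilde, ht]
  rfl

theorem IsCanonicalDecomposition.exists_inner_factor [TopologicalSpace.SeparableSpace E₁]
    {E' : Type*} [NormedAddCommGroup E'] [InnerProductSpace ℂ E'] [CompleteSpace E']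
    [TopologicalSpace.SeparableSpace E'] {Δ : 𝕋 → E' →L[ℂ] E} (hΔ : IsInner Δ)
    (hker : ∀ f ∈ analyticKernel hΦ, ∃ g ∈ H2 E', hΔ.essBounded.mulL g = f)
    (h : IsCanonicalDecomposition b hΦ Δ₁ A₁ B₁) :
    ∃ Θ : 𝕋 → E₁ →L[ℂ] E', IsInner Θ ∧ ∀ᵐ t ∂m, Δ₁ t = Δ t ∘L Θ t :=
  hΔ.exists_inner_factor h.inner fun y =>
    hker _ ((h.inner.isStrongH2_tilde_iff hΦ).1 h.isStrongH2_tilde y)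

/-- The nc condition excludes a Δ₁ that is too small: it makes the inner factor Θ in Δ₁ = ΔΘ square.
Coprimality then excludes a nonconstant Θ, since Δ̃₁ = Θ̃Δ̃ and Ã₁ = Θ̃Ã with A = Φ^*Δ. -/
theorem IsCanonicalDecomposition.exists_unitary_factor [TopologicalSpace.SeparableSpace E]
    [TopologicalSpace.SeparableSpace E₁] [FiniteDimensional ℂ E₁]
    {E' : Type*} [NormedAddCommGroup E'] [InnerProductSpace ℂ E'] [CompleteSpace E']
    [TopologicalSpace.SeparableSpace E'] {Δ : 𝕋 → E' →L[ℂ] E} (hΔ : IsInner Δ)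
    (hker : ∀ f, f ∈ analyticKernel hΦ ↔ ∃ g ∈ H2 E', hΔ.essBounded.mulL g = f)
    (h : IsCanonicalDecomposition b hΦ Δ₁ A₁ B₁) :
    ∃ U : E₁ ≃ₗᵢ[ℂ] E',
      ∀ᵐ t ∂m, Δ₁ t = Δ t ∘L U.toContinuousLinearEquiv.toContinuousLinearMap := by
  obtain ⟨Θ, hΘ, hfac⟩ := h.exists_inner_factor hΔ fun f hf => (hker f).1 hf
  have hmemΔ : ∀ y, hΔ.essBounded.mulL (constL E' y) ∈ analyticKernel hΦ := fun y =>
    (hker _).2 ⟨_, constL_mem_H2 y, rfl⟩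
  obtain ⟨hfin, hle⟩ := finrank_le_of_dim_le
    (((hΔ.dim_le_nc b hΦ hmemΔ).trans h.nc_le).trans_eq dim_eq_finrank)
  obtain ⟨t₀, ht₀⟩ := hΘ.norm_apply.exists
  let T₀ : E₁ →ₗᵢ[ℂ] E' := ⟨(Θ t₀ : E₁ →ₗ[ℂ] E'), ht₀⟩
  have hrank : Module.finrank ℂ E₁ = Module.finrank ℂ E' :=
    le_antisymm (LinearMap.finrank_le_finrank_of_injective T₀.injective) hle
  -- The divisors tested in `LeftCoprime` have initial space in the universe of E₁, which E' need
  -- not share. A constant unitary W moves Θ̃ to initial space E₁.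
  let W : E₁ ≃ₗᵢ[ℂ] E' := T₀.toLinearIsometryEquiv hrank
  let Wc : E₁ →L[ℂ] E' := W.toContinuousLinearEquiv.toContinuousLinearMap
  let Wi : E' →L[ℂ] E₁ := W.symm.toContinuousLinearEquiv.toContinuousLinearMap
  have hWW : Wc ∘L Wi = ContinuousLinearMap.id ℂ E' :=
    ContinuousLinearMap.ext fun y => W.apply_symm_apply y
  have hsurj : ∀ᵐ t ∂m, Function.Surjective (Θ t) := by
    filter_upwards [hΘ.2] with t ht
    exact (LinearMap.injective_iff_surjective_of_finrank_eq_finrank hrank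
      (f := (Θ t : E₁ →ₗ[ℂ] E'))).1 ht.injective
  have hΩH : IsHInfty (fun t => tilde Θ t ∘L Wc) := hΘ.1.tilde.comp (isHInfty_const Wc)
  have hΩ : IsInner (fun t => tilde Θ t ∘L Wc) := by
    refine hΩH.essBounded.isInner_of_norm (hΩH.essBounded.isHInfty_iff.1 hΩH) ?_
    filter_upwards [ae_neg hΘ.norm_apply, ae_neg hsurj] with t h1 h2 x
    exact (norm_adjoint_of_surjective h1 h2 (W x)).trans (W.norm_map x)
  have hcancel : ∀ t, (tilde Θ t ∘L Wc) ∘L Wi = tilde Θ t := fun t => by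
    rw [ContinuousLinearMap.comp_assoc, hWW, ContinuousLinearMap.comp_id]
  have hdivΔ : IsLeftInnerDivisor (fun t => tilde Θ t ∘L Wc) (tilde Δ₁) := by
    refine ⟨hΩ, fun t => Wi ∘L tilde Δ t, hΔ.1.tilde.isStrongH2.const_comp Wi, ?_⟩
    filter_upwards [ae_neg hfac] with t ht
    rw [← ContinuousLinearMap.comp_assoc, hcancel, tilde, ht, ContinuousLinearMap.adjoint_comp]
    rfl
  have hdivA : IsLeftInnerDivisor (fun t => tilde Θ t ∘L Wc) (tilde A₁) := by
    refine ⟨hΩ, fun t => Wi ∘L tilde (fun t => ContinuousLinearMap.adjoint (Φ t) ∘L Δ t) t,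
      ((hΔ.isStrongH2_tilde_iff hΦ).2 hmemΔ).const_comp Wi, ?_⟩
    filter_upwards [ae_neg hfac, ae_neg h.eq_adjoint_comp] with t h1 h2
    rw [← ContinuousLinearMap.comp_assoc, hcancel, tilde, h2, h1]
    simp [tilde, ContinuousLinearMap.adjoint_comp, ContinuousLinearMap.comp_assoc]
  obtain ⟨V, hV⟩ := h.coprime E₁ _ hdivΔ hdivA
  refine ⟨V.symm.trans W, ?_⟩
  filter_upwards [hfac, ae_neg hV] with t h1 h2
  -- Coprimality gives Θ̃W = V, so Θ^* = VW⁻¹ and Θ = WV⁻¹.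
  have h3 : ContinuousLinearMap.adjoint (Θ t)
      = V.toContinuousLinearEquiv.toContinuousLinearMap ∘L Wi := by
    rw [← h2, ContinuousLinearMap.comp_assoc, hWW, ContinuousLinearMap.comp_id, tilde, neg_neg]
  have h4 := congrArg ContinuousLinearMap.adjoint h3
  rw [ContinuousLinearMap.adjoint_adjoint, ContinuousLinearMap.adjoint_comp,
    adjoint_linearIsometryEquiv, adjoint_linearIsometryEquiv] at h4
  rw [h1, h4]
  rfl

omit [CompleteSpace E] [CompleteSpace E₁] in
theorem IsInner.finiteDimensional_of_codomain {Δ : 𝕋 → E₁ →L[ℂ] E} (hΔ : IsInner Δ)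
    [FiniteDimensional ℂ E] : FiniteDimensional ℂ E₁ := by
  obtain ⟨t, ht⟩ := hΔ.2.exists
  exact FiniteDimensional.of_injective (Δ t : E₁ →ₗ[ℂ] E) ht.injective

/-- A constant unitary carries H² onto H², so Δ₁ and Δ have the same range on H². -/
theorem kerHankelAdjoint_eq_rangeH2 {E' : Type*} [NormedAddCommGroup E'] [InnerProductSpace ℂ E']
    [CompleteSpace E'] {Δ : 𝕋 → E' →L[ℂ] E} (hΔ : IsInner Δ)
    (hker : ∀ f, f ∈ analyticKernel hΦ ↔ ∃ g ∈ H2 E', hΔ.essBounded.mulL g = f)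
    (U : E₁ ≃ₗᵢ[ℂ] E')
    (hU : ∀ᵐ t ∂m, Δ₁ t = Δ t ∘L U.toContinuousLinearEquiv.toContinuousLinearMap) :
    kerHankelAdjoint hΦ.flip = rangeH2 Δ₁ := by
  ext f
  rw [mem_kerHankelAdjoint_flip hΦ, hker]
  constructor
  · rintro ⟨g, hg, hgf⟩
    have hT := isHInfty_const U.symm.toContinuousLinearEquiv.toContinuousLinearMap
    refine ⟨hT.mulH2 ⟨g, hg⟩, ?_⟩
    filter_upwards [hU, hΔ.essBounded.coeFn_mulL g, hT.essBounded.coeFn_mulL g] with t h1 h2 h3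
    rw [← hgf, h2, h1, hT.coe_mulH2, h3]
    exact congrArg (Δ t) (U.apply_symm_apply _).symm
  · rintro ⟨g, hg⟩
    have hT := isHInfty_const U.toContinuousLinearEquiv.toContinuousLinearMap
    refine ⟨hT.mulH2 g, (hT.mulH2 g).2, Lp.ext ?_⟩
    filter_upwards [hU, hΔ.essBounded.coeFn_mulL (hT.mulH2 g), hT.essBounded.coeFn_mulL (g : L2 E₁),
      hg] with t h1 h2 h3 h4
    rw [h2, h4, h1, hT.coe_mulH2, h3]
    rfl

/-- A is determined by Δ, and VV^* = 1 leaves ΔA^* unchanged, hence also B. -/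
theorem IsCanonicalDecomposition.eq_of_comp_unitary {E₂ : Type*} [NormedAddCommGroup E₂]
    [InnerProductSpace ℂ E₂] [CompleteSpace E₂] {Δ₂ : 𝕋 → E₂ →L[ℂ] E} {A₂ : 𝕋 → E₂ →L[ℂ] D}
    {B₂ : 𝕋 → D →L[ℂ] E} (h₁ : IsCanonicalDecomposition b hΦ Δ₁ A₁ B₁)
    (h₂ : IsCanonicalDecomposition b hΦ Δ₂ A₂ B₂) (V : E₂ ≃ₗᵢ[ℂ] E₁)
    (hV : ∀ᵐ t ∂m, Δ₂ t = Δ₁ t ∘L V.toContinuousLinearEquiv.toContinuousLinearMap) :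
    (∀ᵐ t ∂m, A₂ t = A₁ t ∘L V.toContinuousLinearEquiv.toContinuousLinearMap) ∧
      ∀ᵐ t ∂m, B₂ t = B₁ t := by
  have hA : ∀ᵐ t ∂m, A₂ t = A₁ t ∘L V.toContinuousLinearEquiv.toContinuousLinearMap := by
    filter_upwards [hV, h₁.eq_adjoint_comp, h₂.eq_adjoint_comp] with t h h1 h2
    rw [h2, h, h1, ContinuousLinearMap.comp_assoc]
  refine ⟨hA, ?_⟩
  filter_upwards [hV, hA, h₁.eq_add, h₂.eq_add] with t h h1 h2 h3
  have h4 : Δ₂ t ∘L ContinuousLinearMap.adjoint (A₂ t)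
      = Δ₁ t ∘L ContinuousLinearMap.adjoint (A₁ t) := by
    rw [h, h1, ContinuousLinearMap.adjoint_comp, adjoint_linearIsometryEquiv]
    ext x
    exact congrArg (Δ₁ t) (V.apply_symm_apply _)
  rw [h4] at h3
  exact add_left_cancel (h3.symm.trans h2)

end Uniqueness

end StrongL2

end

/-! ### The main theorem -/

theorem theorem5p1 {D : Type v} {E : Type u}
    [NormedAddCommGroup D] [InnerProductSpace ℂ D] [CompleteSpace D]
    [TopologicalSpace.SeparableSpace D]
    [NormedAddCommGroup E] [InnerProductSpace ℂ E] [CompleteSpace E]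
    [TopologicalSpace.SeparableSpace E]
    (Φ : StrongL2.𝕋 → D →L[ℂ] E) (hΦ : StrongL2.IsStrongL2 Φ) :
    -- existence
    (∃ (E' : Type u) (_ : NormedAddCommGroup E') (_ : InnerProductSpace ℂ E')
        (_ : CompleteSpace E') (_ : TopologicalSpace.SeparableSpace E')
        (Δ : StrongL2.𝕋 → E' →L[ℂ] E) (A : StrongL2.𝕋 → E' →L[ℂ] D)
        (B : StrongL2.𝕋 → D →L[ℂ] E),
        ∀ (ι : Type w) (b : HilbertBasis ι ℂ D),
          StrongL2.IsCanonicalDecomposition b hΦ Δ A B) ∧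
    -- uniqueness and description of `Δ` when `dim E' < ∞`
    (∀ (ι : Type w) (b : HilbertBasis ι ℂ D)
        (E₁ : Type r) [NormedAddCommGroup E₁] [InnerProductSpace ℂ E₁] [CompleteSpace E₁]
        [TopologicalSpace.SeparableSpace E₁]
        (Δ₁ : StrongL2.𝕋 → E₁ →L[ℂ] E) (A₁ : StrongL2.𝕋 → E₁ →L[ℂ] D)
        (B₁ : StrongL2.𝕋 → D →L[ℂ] E),
        StrongL2.IsCanonicalDecomposition b hΦ Δ₁ A₁ B₁ →
        (FiniteDimensional ℂ E₁ ∨ FiniteDimensional ℂ E) →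
          StrongL2.kerHankelAdjoint hΦ.flip = StrongL2.rangeH2 Δ₁ ∧
          ∀ (E₂ : Type s) [NormedAddCommGroup E₂] [InnerProductSpace ℂ E₂] [CompleteSpace E₂]
            [TopologicalSpace.SeparableSpace E₂]
            (Δ₂ : StrongL2.𝕋 → E₂ →L[ℂ] E) (A₂ : StrongL2.𝕋 → E₂ →L[ℂ] D)
            (B₂ : StrongL2.𝕋 → D →L[ℂ] E),
            StrongL2.IsCanonicalDecomposition b hΦ Δ₂ A₂ B₂ →
              ∃ V : E₂ ≃ₗᵢ[ℂ] E₁,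
                (∀ᵐ t ∂StrongL2.m,
                  Δ₂ t = Δ₁ t ∘L V.toContinuousLinearEquiv.toContinuousLinearMap) ∧
                (∀ᵐ t ∂StrongL2.m,
                  A₂ t = A₁ t ∘L V.toContinuousLinearEquiv.toContinuousLinearMap) ∧
                (∀ᵐ t ∂StrongL2.m, B₂ t = B₁ t)) := by
  obtain ⟨E', _, _, _, _, Δ, hΔ, hker⟩ := StrongL2.exists_inner_of_shift_invariant
    (M := StrongL2.analyticKernel hΦ) StrongL2.isClosed_analyticKernel inf_le_left
    fun _ => StrongL2.mulZ_mem_analyticKernel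
  refine ⟨⟨E', _, _, inferInstance, inferInstance, Δ, _, _, fun ι b =>
    StrongL2.isCanonicalDecomposition_of_analyticKernel hΦ hΔ hker b⟩, ?_⟩
  intro ι b E₁ _ _ _ _ Δ₁ A₁ B₁ h₁ hfin
  have hfin₁ : FiniteDimensional ℂ E₁ :=
    hfin.elim id fun _ => h₁.inner.finiteDimensional_of_codomain
  obtain ⟨U₁, hU₁⟩ := h₁.exists_unitary_factor hΔ hker
  refine ⟨StrongL2.kerHankelAdjoint_eq_rangeH2 hΔ hker U₁ hU₁, ?_⟩
  intro E₂ _ _ _ _ Δ₂ A₂ B₂ h₂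
  -- Nothing is assumed on dim E₂: it is finite because Θ is isometric from E₂ into E', which is
  -- isometric to E₁.
  have hfin' : FiniteDimensional ℂ E' := U₁.toLinearEquiv.finiteDimensional
  obtain ⟨Θ, hΘ, -⟩ := h₂.exists_inner_factor hΔ fun f hf => (hker f).1 hf
  have hfin₂ : FiniteDimensional ℂ E₂ := hΘ.finiteDimensional_of_codomain
  obtain ⟨U₂, hU₂⟩ := h₂.exists_unitary_factor hΔ hker
  have hV : ∀ᵐ t ∂StrongL2.m, Δ₂ t
      = Δ₁ t ∘L (U₂.trans U₁.symm).toContinuousLinearEquiv.toContinuousLinearMap := by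
    filter_upwards [hU₁, hU₂] with t h1 h2
    rw [h1, h2]
    ext x
    exact congrArg (Δ t) (U₁.apply_symm_apply _).symm
  exact ⟨U₂.trans U₁.symm, hV, h₁.eq_of_comp_unitary h₂ _ hV⟩
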